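/- Let $n\ge 5$ be an integer with $n\neq 28$. Suppose that a regular $n$-gon is tiled by finitely many similar right triangles, that is, it is the union of finitely many (closed, non-degenerate) right triangles, any two of which are similar (reflections allowed) and have disjoint interiors; a vertex of one triangle may lie in the interior of a side of another. Then the smaller acute angle $\alpha$ of these triangles (where $\alpha=\pi/4$ if they are isosceles) satisfies $$\alpha\in\left\{\frac{\pi}{n},\ \frac{2\pi}{n},\ \frac{\pi}{6}+\frac{2\pi}{3n}\right\}.$$ -/

import Mathlib

open scoped Similar

noncomputable section

/-- The vertices of the regular `n`-gon in the Euclidean plane `ℂ` with centre `c` and with `c + w`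
as one of its vertices: the points obtained from `c + w` by the rotations about `c` through the
multiples of `2π / n`. -/
def regularPolygonVertex (n : ℕ) (c w : ℂ) (k : Fin n) : ℂ :=
  c + w * Complex.exp (((2 * Real.pi * (k : ℕ) / n : ℝ) : ℂ) * Complex.I)

/-- `P` is a (filled, closed) regular `n`-gon in the Euclidean plane `ℂ`, of any position and
size. -/
def IsRegularPolygon (n : ℕ) (P : Set ℂ) : Prop :=
  3 ≤ n ∧ ∃ c w : ℂ, w ≠ 0 ∧ P = convexHull ℝ (Set.range (regularPolygonVertex n c w))

/-- The angle of the triangle `t` at its vertex `t.points i`. -/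
def triangleAngle (t : Affine.Triangle ℝ ℂ) (i : Fin 3) : ℝ :=
  EuclideanGeometry.angle (t.points (i + 1)) (t.points i) (t.points (i + 2))

/-- A right triangle: one of the angles equals `π / 2`. -/
def IsRightTriangle (t : Affine.Triangle ℝ ℂ) : Prop :=
  ∃ i, triangleAngle t i = Real.pi / 2

/-- The smallest angle of a triangle; in a right triangle it is the smaller acute angle (and the
common value of the two acute angles if the triangle is isosceles). -/
def smallestAngle (t : Affine.Triangle ℝ ℂ) : ℝ :=
  min (triangleAngle t 0) (min (triangleAngle t 1) (triangleAngle t 2))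

/-- Two triangles are similar if this holds for some correspondence between their vertices.
Reflections are allowed. -/
def SimilarTriangles (s t : Affine.Triangle ℝ ℂ) : Prop :=
  ∃ e : Equiv.Perm (Fin 3), (s.points ∘ e) ∼ t.points

/-- The finite family of triangles `T` is a tiling of `P`: the closed triangles cover exactly `P`,
and the open triangles are pairwise disjoint. A vertex of one triangle may lie on a side of
another one. -/
structure IsTiling {ι : Type*} [Finite ι] (T : ι → Affine.Triangle ℝ ℂ) (P : Set ℂ) : Prop where
  iUnion_eq : ⋃ i, (T i).closedInterior = P
  disjoint : ∀ i j, i ≠ j → Disjoint (T i).interior (T j).interior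

end

/-!
Why the theorem is true.  Let `α ≤ β` be the acute angles of the tiles.

*Angles.*  If `p`, `q` and `r` of the angles `α`, `β` and `π / 2` meet at a vertex of the `n`-gon, then
`p α + q β + r π / 2 = π - 2π / n`.  For `p < q` this leaves only the three values of the theorem, and
`p = q` is impossible since `n ≥ 5` (`corner_equation`).  So suppose that `p > q` at every vertex of the
`n`-gon.  In the whole tiling `α` and `β` occur equally often, hence there is some other vertex of
the tiling, with angle sum `π` or `2π`, at which `p < q`.  The latter equation bounds the
denominator of `α / π`, and the two equations together leave, apart from `n = 28`, only `n = 5` with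
`α = π / 10` and `n = 7` with `α = 3π / 14` (`angle_cases`).

*Areas.*  These two cases are excluded by a conjugation of the cyclotomic field of the `2n`-th roots of
unity.  It extends to an additive map `F` of the plane, semilinear over that field
(`exists_semilinear`).  Its values on the vertices of the tiles define a generalized tiling, in which the
tiles are again similar right triangles, the regular polygon becomes a star polygon, and the signed
areas of the tiles still add up to that of the polygon (`sum_edgeTerm_eq`).  All tiles change their
orientation or none does, so the sign of their area has to agree with that of the star polygon
(`tan_mul_sin_nonneg`).  For `ζ ↦ ζ ^ 3` this fails in both cases.

*Local structure.*  The angle equations and the additivity of the signed area both come from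
`sum_germ_increment`.  In the neighbourhood of a point `x` a convex polygon consists of the rays from
`x` in an arc of directions, its germ.  The germs of the tiles at `x` make up the germ of the tiled
polygon, so for every function `ε` of the direction that changes by a constant along a full turn, the
increments of `ε` along the germs of the tiles add up to that along the germ of the polygon.  With
`ε θ = θ` this is the angle equation at `x`.  For a suitable `π`-periodic `ε` (`linePrimitive`) only
germs at vertices contribute, and summation over all `x` yields the signed areas.
-/

noncomputable section

open Filter Topology

/-! ### Step functions and arcs -/

theorem eventually_notMem_of_finite {B : Set ℝ} (hB : B.Finite) (t σ : ℝ) (hσ : σ ≠ 0) :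
    ∀ᶠ h in 𝓝[>] (0 : ℝ), t + σ * h ∉ B := by
  have hfin : ((fun h : ℝ => t + σ * h) ⁻¹' B).Finite := by
    refine hB.preimage ?_
    intro x _ y _ hxy
    simpa [hσ] using hxy
  have h0 : ((fun h : ℝ => t + σ * h) ⁻¹' B \ {0}).Finite := hfin.subset Set.sdiff_subset
  have h1 : ((fun h : ℝ => t + σ * h) ⁻¹' B \ {0})ᶜ ∈ 𝓝 (0 : ℝ) :=
    h0.isClosed.isOpen_compl.mem_nhds (by simp)
  filter_upwards [mem_nhdsWithin_of_mem_nhds h1, self_mem_nhdsWithin] with h hh hpos hmem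
  exact hh ⟨hmem, by simpa using (ne_of_gt hpos)⟩

/-- The jump at `t` of the indicator function of `[a, b)`. -/
theorem eventually_jump_Ico {a b : ℝ} (hab : a ≤ b) (t : ℝ) :
    ∀ᶠ h in 𝓝[>] (0 : ℝ),
      ((if a ≤ t + h ∧ t + h < b then (1 : ℝ) else 0) -
        (if a ≤ t - h ∧ t - h < b then (1 : ℝ) else 0)) =
      (if a = t then 1 else 0) - (if b = t then 1 else 0) := by
  have key : ∀ c : ℝ, ∀ᶠ h in 𝓝[>] (0 : ℝ),
      ((t + h < c ↔ t < c) ∧ (t - h < c ↔ t ≤ c)) := by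
    intro c
    rcases lt_trichotomy t c with hc | hc | hc
    · have : Set.Iio (c - t) ∈ 𝓝 (0 : ℝ) := Iio_mem_nhds (by linarith)
      filter_upwards [mem_nhdsWithin_of_mem_nhds this, self_mem_nhdsWithin] with h h1 h2
      simp only [Set.mem_Iio, Set.mem_Ioi] at h1 h2
      constructor <;> constructor <;> intro _ <;> linarith
    · filter_upwards [self_mem_nhdsWithin] with h h2
      simp only [Set.mem_Ioi] at h2
      constructor <;> constructor <;> intro _ <;> linarith
    · have : Set.Iio (t - c) ∈ 𝓝 (0 : ℝ) := Iio_mem_nhds (by linarith)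
      filter_upwards [mem_nhdsWithin_of_mem_nhds this, self_mem_nhdsWithin] with h h1 h2
      simp only [Set.mem_Iio, Set.mem_Ioi] at h1 h2
      constructor <;> constructor <;> intro _ <;> linarith
  filter_upwards [key a, key b] with h ha hb
  have e1 : (a ≤ t + h ∧ t + h < b) ↔ (a ≤ t ∧ t < b) := by
    rw [← not_lt, ha.1, hb.1, not_lt]
  have e2 : (a ≤ t - h ∧ t - h < b) ↔ (a < t ∧ t ≤ b) := by
    rw [← not_lt, ha.2, hb.2, not_le]
  simp only [e1, e2]
  rcases lt_trichotomy a t with h1 | h1 | h1 <;> rcases lt_trichotomy b t with h2 | h2 | h2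
  all_goals
    first
    | (exfalso; linarith)
    | (simp [h1, h2, h1.le, h2.le, h1.ne, h2.ne, h1.ne', h2.ne', not_lt.2 h1.le, not_lt.2 h2.le,
        not_le.2 h1, not_le.2 h2])
    | (subst h1; simp [h2, h2.le, h2.ne'])
    | (subst h2; simp [h1, h1.le, h1.ne])
    | (subst h1; subst h2; simp)

/-- Every function `ε` defines a finitely additive integral on step functions: if a combination of
indicator functions of intervals vanishes off a finite set, so does the same combination of the
increments of `ε`. -/
theorem sum_increment_eq_zero_of_intervals {ι : Type*} [Fintype ι] (a b c : ι → ℝ)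
    (hab : ∀ i, a i ≤ b i) {B : Set ℝ} (hB : B.Finite)
    (h0 : ∀ t, t ∉ B → ∑ i, c i * (Set.Ico (a i) (b i)).indicator 1 t = 0) (ε : ℝ → ℝ) :
    ∑ i, c i * (ε (b i) - ε (a i)) = 0 := by
  classical
  simp only [Set.indicator_apply, Set.mem_Ico, Pi.one_apply] at h0
  -- the jump at `t` of the vanishing combination
  have jump : ∀ t, ∑ i, c i * ((if a i = t then (1 : ℝ) else 0) - (if b i = t then 1 else 0)) = 0 := by
    intro t
    have h1 := eventually_notMem_of_finite hB t 1 one_ne_zero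
    have h2 := eventually_notMem_of_finite hB t (-1) (by norm_num)
    have h3 := eventually_all.2 fun i => eventually_jump_Ico (hab i) t
    obtain ⟨h, h1, h2, h3⟩ := (h1.and (h2.and h3)).exists
    have e1 := h0 _ h1
    have e2 := h0 _ h2
    simp only [one_mul, neg_mul, ← sub_eq_add_neg] at e1 e2
    calc _ = ∑ i, c i * ((if a i ≤ t + h ∧ t + h < b i then (1 : ℝ) else 0) -
        (if a i ≤ t - h ∧ t - h < b i then (1 : ℝ) else 0)) :=
          Finset.sum_congr rfl fun i _ => by rw [h3 i]
      _ = 0 := by simp only [mul_sub, Finset.sum_sub_distrib, e1, e2, sub_zero]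
  set S : Finset ℝ := Finset.univ.image a ∪ Finset.univ.image b with hS
  have ha : ∀ i, a i ∈ S := fun i => by simp [hS]
  have hb : ∀ i, b i ∈ S := fun i => by simp [hS]
  have : ∀ i, c i * (ε (b i) - ε (a i)) = -∑ t ∈ S, ε t *
      (c i * ((if a i = t then (1 : ℝ) else 0) - (if b i = t then 1 else 0))) := by
    intro i
    simp only [mul_sub, Finset.sum_sub_distrib, mul_ite, mul_one, mul_zero, Finset.sum_ite_eq, ha, hb,
      if_true]
    ring
  rw [Finset.sum_congr rfl fun i _ => this i, Finset.sum_neg_distrib, Finset.sum_comm]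
  simp only [← Finset.mul_sum, jump, mul_zero, Finset.sum_const_zero, neg_zero]

/-- The arc of length `φ` on the circle of directions that starts at `s`, as a set of real
arguments: it is `2π`-periodic, empty for `φ = 0` and everything for `φ = 2π`. -/
def arc (s φ : ℝ) : Set ℝ := {θ | ∃ m : ℤ, s ≤ θ + 2 * Real.pi * m ∧ θ + 2 * Real.pi * m < s + φ}

theorem mem_arc_add_int {s φ θ : ℝ} (k : ℤ) :
    θ + 2 * Real.pi * k ∈ arc s φ ↔ θ ∈ arc s φ := by
  constructor
  · rintro ⟨m, h1, h2⟩
    refine ⟨k + m, ?_, ?_⟩ <;> push_cast <;> linarith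
  · rintro ⟨m, h1, h2⟩
    refine ⟨m - k, ?_, ?_⟩ <;> push_cast <;> linarith

theorem arc_add_int (s φ : ℝ) (k : ℤ) : arc (s + 2 * Real.pi * k) φ = arc s φ := by
  ext θ
  constructor
  · rintro ⟨m, h1, h2⟩
    refine ⟨m - k, ?_, ?_⟩ <;> push_cast <;> linarith
  · rintro ⟨m, h1, h2⟩
    refine ⟨m + k, ?_, ?_⟩ <;> push_cast <;> linarith

theorem arc_zero (s : ℝ) : arc s 0 = ∅ := by
  ext θ
  simp only [arc, Set.mem_ofPred_eq, Set.mem_empty_iff_false, iff_false]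
  rintro ⟨m, h1, h2⟩
  linarith

theorem exists_int_add_mem_Ico (s θ : ℝ) :
    ∃ m : ℤ, s ≤ θ + 2 * Real.pi * m ∧ θ + 2 * Real.pi * m < s + 2 * Real.pi := by
  obtain ⟨m, hm, -⟩ := existsUnique_add_zsmul_mem_Ico Real.two_pi_pos θ s
  refine ⟨m, ?_⟩
  simpa [mul_comm] using hm

theorem arc_two_pi (s : ℝ) : arc s (2 * Real.pi) = Set.univ := by
  ext θ
  simpa [arc] using exists_int_add_mem_Ico s θ

/-- On a period, an arc is the disjoint union of two intervals. -/
theorem indicator_arc_eq {s φ θ : ℝ} (hs : 0 ≤ s) (hs' : s < 2 * Real.pi)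
    (hφ' : φ ≤ 2 * Real.pi) (hθ : 0 ≤ θ) (hθ' : θ < 2 * Real.pi) :
    (arc s φ).indicator (1 : ℝ → ℝ) θ = (Set.Ico s (min (s + φ) (2 * Real.pi))).indicator 1 θ +
      (Set.Ico 0 (max (s + φ - 2 * Real.pi) 0)).indicator 1 θ := by
  classical
  simp only [Set.indicator_apply, Set.mem_Ico, Pi.one_apply]
  have hpi := Real.pi_pos
  have h : θ ∈ arc s φ ↔ (s ≤ θ ∧ θ < s + φ) ∨ (θ < s + φ - 2 * Real.pi) := by
    constructor
    · rintro ⟨m, h1, h2⟩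
      have hm0 : (-1 : ℤ) < m := by
        by_contra hcon
        have : (m : ℝ) ≤ -1 := by exact_mod_cast not_lt.1 hcon
        nlinarith
      have hm1 : m < 2 := by
        by_contra hcon
        have : (2 : ℝ) ≤ m := by exact_mod_cast not_lt.1 hcon
        nlinarith
      obtain rfl | rfl : m = 0 ∨ m = 1 := by omega
      · left; constructor <;> [simpa using h1; simpa using h2]
      · right; push_cast at h2; linarith
    · rintro (⟨h1, h2⟩ | h1)
      · exact ⟨0, by simpa using h1, by simpa using h2⟩
      · exact ⟨1, by push_cast; linarith, by push_cast; linarith⟩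
  by_cases h1 : s ≤ θ ∧ θ < s + φ
  · have h2 : ¬ (θ < s + φ - 2 * Real.pi) := by intro h; linarith [h1.1]
    simp [h, h1, h2, hθ, hθ', not_lt.2 hθ]
  · by_cases h2 : θ < s + φ - 2 * Real.pi
    · have h3 : θ < s := by linarith
      simp [h, h2, hθ, not_le.2 h3]
    · have h4 : ¬ (s ≤ θ ∧ θ < min (s + φ) (2 * Real.pi)) := fun h5 =>
        h1 ⟨h5.1, h5.2.trans_le (min_le_left _ _)⟩
      have h5 : ¬ (0 ≤ θ ∧ θ < max (s + φ - 2 * Real.pi) 0) := fun h6 => by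
        rcases lt_max_iff.1 h6.2 with h7 | h7
        · exact h2 h7
        · linarith
      rw [if_neg (by rw [h]; tauto), if_neg h4, if_neg h5, add_zero]

theorem quasiperiodic_int {ε : ℝ → ℝ} {κ : ℝ} (hε : ∀ θ, ε (θ + 2 * Real.pi) = ε θ + κ) (θ : ℝ)
    (m : ℤ) : ε (θ + 2 * Real.pi * m) = ε θ + κ * m := by
  induction m with
  | zero => simp
  | succ n ih =>
    have := hε (θ + 2 * Real.pi * (n : ℤ))
    rw [ih] at this
    push_cast at this ⊢
    rw [show θ + 2 * Real.pi * (n + 1) = θ + 2 * Real.pi * n + 2 * Real.pi by ring, this]; ring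
  | pred n ih =>
    have := hε (θ + 2 * Real.pi * (-(n : ℤ) - 1 : ℤ))
    push_cast at this ih ⊢
    rw [show θ + 2 * Real.pi * (-(n : ℝ) - 1) + 2 * Real.pi = θ + 2 * Real.pi * -n by ring, ih] at this
    linarith

/-- The circular version of `sum_increment_eq_zero_of_intervals`, for integrators `ε` which change by a
constant along a full turn. -/
theorem sum_increment_eq_zero_of_arcs {ι : Type*} [Fintype ι] (s φ c : ι → ℝ)
    (hφ : ∀ i, 0 ≤ φ i) (hφ' : ∀ i, φ i ≤ 2 * Real.pi) {B : Set ℝ}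
    (hB : (B ∩ Set.Ico 0 (2 * Real.pi)).Finite)
    (h0 : ∀ t, t ∉ B → ∑ i, c i * (arc (s i) (φ i)).indicator 1 t = 0) {ε : ℝ → ℝ} {κ : ℝ}
    (hε : ∀ θ, ε (θ + 2 * Real.pi) = ε θ + κ) :
    ∑ i, c i * (ε (s i + φ i) - ε (s i)) = 0 := by
  classical
  have hpi := Real.pi_pos
  -- move the starting points to the period `[0, 2π)` and cut the arcs at its end
  choose m hm using fun i => exists_int_add_mem_Ico 0 (s i)
  simp only [zero_add] at hm
  set s' : ι → ℝ := fun i => s i + 2 * Real.pi * m i with hs'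
  have harc : ∀ i, arc (s i) (φ i) = arc (s' i) (φ i) := fun i => (arc_add_int _ _ _).symm
  have hinc : ∀ i, ε (s i + φ i) - ε (s i) = ε (s' i + φ i) - ε (s' i) := by
    intro i
    simp only [hs', quasiperiodic_int hε]
    rw [show s i + 2 * Real.pi * m i + φ i = s i + φ i + 2 * Real.pi * m i by ring,
      quasiperiodic_int hε]
    ring
  have := sum_increment_eq_zero_of_intervals (ι := ι ⊕ ι)
    (Sum.elim s' fun _ => 0)
    (Sum.elim (fun i => min (s' i + φ i) (2 * Real.pi)) fun i => max (s' i + φ i - 2 * Real.pi) 0)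
    (Sum.elim c c) (by
      rintro (i | i)
      · simp only [Sum.elim_inl]
        exact le_min (by linarith [hφ i]) (hm i).2.le
      · simp)
    hB (by
      intro t ht
      rw [Fintype.sum_sum_type]
      simp only [Sum.elim_inl, Sum.elim_inr]
      by_cases hI : t ∈ Set.Ico 0 (2 * Real.pi)
      · have htB : t ∉ B := fun h => ht ⟨h, hI⟩
        refine Eq.trans ?_ (h0 t htB)
        rw [← Finset.sum_add_distrib]
        refine Finset.sum_congr rfl fun i _ => ?_
        rw [harc i, ← mul_add, indicator_arc_eq (hm i).1 (hm i).2 (hφ' i) hI.1 hI.2]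
      · rw [Finset.sum_eq_zero, Finset.sum_eq_zero, add_zero]
        · intro i _
          rw [Set.indicator_of_notMem, mul_zero]
          rintro ⟨h1, h2⟩
          refine hI ⟨h1, h2.trans_le (max_le ?_ (by positivity))⟩
          linarith [(hm i).2, hφ' i]
        · intro i _
          rw [Set.indicator_of_notMem, mul_zero]
          rintro ⟨h1, h2⟩
          exact hI ⟨(hm i).1.trans h1, h2.trans_le (min_le_right _ _)⟩) ε
  rw [Fintype.sum_sum_type, ← Finset.sum_add_distrib] at this
  rw [← this]
  refine Finset.sum_congr rfl fun i _ => ?_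
  simp only [Sum.elim_inl, Sum.elim_inr]
  rw [hinc i, ← mul_add]
  congr 1
  have h2 := hε 0
  rw [zero_add] at h2
  rcases le_total (s' i + φ i) (2 * Real.pi) with h | h
  · rw [min_eq_left h, max_eq_right (by linarith)]; ring
  · rw [min_eq_right h, max_eq_left (by linarith)]
    have h1 := hε (s' i + φ i - 2 * Real.pi)
    rw [sub_add_cancel] at h1
    rw [h1, h2]; ring

/-! ### Convex polygons -/

/-- The cross product of two vectors of the plane: twice the signed area of the triangle with
vertices `0, u, v`. -/
def cross (u v : ℂ) : ℝ := u.re * v.im - u.im * v.re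

/-- The unit vector with argument `θ`. -/
def unitVec (θ : ℝ) : ℂ := Complex.exp (θ * Complex.I)

theorem unitVec_re (θ : ℝ) : (unitVec θ).re = Real.cos θ := Complex.exp_ofReal_mul_I_re θ

theorem unitVec_im (θ : ℝ) : (unitVec θ).im = Real.sin θ := Complex.exp_ofReal_mul_I_im θ

theorem unitVec_add (α β : ℝ) : unitVec (α + β) = unitVec α * unitVec β := by
  simp [unitVec, add_mul, Complex.exp_add]

theorem norm_mul_unitVec_arg (d : ℂ) : (‖d‖ : ℂ) * unitVec d.arg = d :=
  Complex.norm_mul_exp_arg_mul_I d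

theorem cross_polar (ρ α θ : ℝ) : cross (ρ * unitVec α) (unitVec θ) = ρ * Real.sin (θ - α) := by
  simp only [cross, Complex.re_ofReal_mul, Complex.im_ofReal_mul, unitVec_re, unitVec_im,
    Real.sin_sub]
  ring

theorem cross_unitVec (d : ℂ) (θ : ℝ) : cross d (unitVec θ) = ‖d‖ * Real.sin (θ - d.arg) := by
  conv_lhs => rw [← norm_mul_unitVec_arg d]
  exact cross_polar _ _ _

theorem cross_swap (u v : ℂ) : cross u v = -cross v u := by simp only [cross]; ring

theorem cross_same (u : ℂ) : cross u u = 0 := by simp only [cross]; ring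

theorem cross_neg_left (u v : ℂ) : cross (-u) v = -cross u v := by
  simp only [cross, Complex.neg_re, Complex.neg_im]; ring

theorem cross_neg_right (u v : ℂ) : cross u (-v) = -cross u v := by
  simp only [cross, Complex.neg_re, Complex.neg_im]; ring

theorem cross_add_left (u v w : ℂ) : cross (u + v) w = cross u w + cross v w := by
  simp only [cross, Complex.add_re, Complex.add_im]; ring

theorem cross_add_right (u v w : ℂ) : cross u (v + w) = cross u v + cross u w := by
  simp only [cross, Complex.add_re, Complex.add_im]; ring

theorem cross_ofReal_mul_right (u v : ℂ) (r : ℝ) : cross u (r * v) = r * cross u v := by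
  simp only [cross, Complex.re_ofReal_mul, Complex.im_ofReal_mul]; ring

theorem cross_mul_mul (a u v : ℂ) : cross (a * u) (a * v) = Complex.normSq a * cross u v := by
  simp only [cross, Complex.mul_re, Complex.mul_im, Complex.normSq_apply]; ring

theorem eq_ofReal_mul_of_cross_eq_zero {d z : ℂ} (hd : d ≠ 0) (h : cross d z = 0) :
    ∃ t : ℝ, z = t * d := by
  have hd' : Complex.normSq d ≠ 0 := by simpa using hd
  refine ⟨(z.re * d.re + z.im * d.im) / Complex.normSq d, ?_⟩
  simp only [cross] at h
  apply Complex.ext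
  · rw [Complex.re_ofReal_mul, div_mul_eq_mul_div, eq_div_iff hd', Complex.normSq_apply]
    linear_combination (-d.im) * h
  · rw [Complex.im_ofReal_mul, div_mul_eq_mul_div, eq_div_iff hd', Complex.normSq_apply]
    linear_combination (d.re) * h

section Polygon

variable {n : ℕ} [NeZero n]

/-- The edge vector from the `j`-th vertex of a closed polygonal line to the next one. -/
def edge (v : Fin n → ℂ) (j : Fin n) : ℂ := v (j + 1) - v j

/-- The function that is positive to the left of the `j`-th edge and negative to its right. -/
def side (v : Fin n → ℂ) (j : Fin n) (z : ℂ) : ℝ := cross (edge v j) (z - v j)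

/-- The vertices of a strictly convex polygon, listed counterclockwise: to the left of every edge lie
all vertices other than its end points. -/
def IsConvexPolygon (v : Fin n → ℂ) : Prop := ∀ j k, k ≠ j → k ≠ j + 1 → 0 < side v j (v k)

/-- The interior of a convex polygon, as an intersection of open half planes. -/
def openRegion (v : Fin n → ℂ) : Set ℂ := {z | ∀ j, 0 < side v j z}

/-- The closed convex polygon, as an intersection of closed half planes. -/
def closedRegion (v : Fin n → ℂ) : Set ℂ := {z | ∀ j, 0 ≤ side v j z}

/-- The angle of a polygon at its `j`-th vertex. It is the unoriented angle between the two adjacent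
edges, which is the correct one for convex polygons. -/
def interiorAngle (v : Fin n → ℂ) (j : Fin n) : ℝ :=
  InnerProductGeometry.angle (edge v j) (v (j - 1) - v j)

theorem openRegion_subset_closedRegion (v : Fin n → ℂ) : openRegion v ⊆ closedRegion v :=
  fun _ hz j => (hz j).le

theorem fin_add_one_ne (hn : 2 ≤ n) (j : Fin n) : j + 1 ≠ j := by
  intro h
  have h1 : (1 : Fin n) = 0 := by simpa using h
  have := congrArg Fin.val h1
  rw [Fin.val_zero, Fin.val_one', Nat.mod_eq_of_lt (by omega)] at this
  omega

theorem fin_add_two_ne (hn : 3 ≤ n) (j : Fin n) : j + 1 + 1 ≠ j := by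
  intro h
  have h1 : (1 + 1 : Fin n) = 0 := by
    rw [add_assoc] at h; simpa using h
  have := congrArg Fin.val h1
  rw [Fin.val_zero, Fin.val_add, Fin.val_one', Nat.mod_eq_of_lt (show 1 < n by omega),
    Nat.mod_eq_of_lt (by omega)] at this
  omega

theorem side_self (v : Fin n → ℂ) (j : Fin n) : side v j (v j) = 0 := by simp [side, cross]

theorem side_next (v : Fin n → ℂ) (j : Fin n) : side v j (v (j + 1)) = 0 := cross_same _

theorem side_add (v : Fin n → ℂ) (j : Fin n) (x u : ℂ) (r : ℝ) :
    side v j (x + r * u) = side v j x + r * cross (edge v j) u := by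
  rw [side, side, ← cross_ofReal_mul_right, ← cross_add_right]
  congr 1; ring

theorem IsConvexPolygon.side_vertex_nonneg {v : Fin n → ℂ} (hv : IsConvexPolygon v) (j k : Fin n) :
    0 ≤ side v j (v k) := by
  by_cases h1 : k = j
  · rw [h1, side_self]
  · by_cases h2 : k = j + 1
    · rw [h2, side_next]
    · exact (hv j k h1 h2).le

theorem IsConvexPolygon.cross_edge_pos {v : Fin n → ℂ} (hv : IsConvexPolygon v) (hn : 3 ≤ n)
    (j : Fin n) : 0 < cross (edge v j) (edge v (j + 1)) := by
  have h := hv j (j + 1 + 1) (fin_add_two_ne hn j) (fin_add_one_ne (by omega) _)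
  rw [side, show v (j + 1 + 1) - v j = edge v (j + 1) + edge v j by simp only [edge]; ring,
    cross_add_right, cross_same, add_zero] at h
  exact h

theorem IsConvexPolygon.edge_ne_zero {v : Fin n → ℂ} (hv : IsConvexPolygon v) (hn : 3 ≤ n)
    (j : Fin n) : edge v j ≠ 0 := by
  intro h
  have := hv.cross_edge_pos hn j
  simp [h, cross] at this

theorem IsConvexPolygon.injective {v : Fin n → ℂ} (hv : IsConvexPolygon v) (hn : 3 ≤ n) :
    Function.Injective v := by
  intro j k hjk
  by_contra hne
  by_cases h : k = j + 1
  · apply hv.edge_ne_zero hn j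
    rw [edge, ← h, hjk, sub_self]
  · have := hv j k (fun h => hne h.symm) h
    rw [← hjk, side_self] at this
    exact lt_irrefl _ this

theorem IsConvexPolygon.exists_of_side_eq_zero {v : Fin n → ℂ} (hv : IsConvexPolygon v) (hn : 3 ≤ n)
    {x : ℂ} (hx : x ∈ closedRegion v) {j : Fin n} (hj : side v j x = 0) :
    ∃ t : ℝ, 0 ≤ t ∧ t ≤ 1 ∧ x = v j + t * edge v j := by
  obtain ⟨t, ht⟩ := eq_ofReal_mul_of_cross_eq_zero (hv.edge_ne_zero hn j) hj
  have hx' : x = v j + t * edge v j := by rw [← ht]; ring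
  refine ⟨t, ?_, ?_, hx'⟩
  · have h1 := hx (j - 1)
    have h2 := hv.cross_edge_pos hn (j - 1)
    have h3 := side_next v (j - 1)
    rw [sub_add_cancel] at h2 h3
    rw [hx', side_add, h3, zero_add] at h1
    exact nonneg_of_mul_nonneg_left h1 h2
  · have h1 := hx (j + 1)
    have h2 := hv.cross_edge_pos hn j
    have e : x = v (j + 1) + ((t - 1 : ℝ) : ℂ) * edge v j := by
      rw [hx']; simp only [edge]; push_cast; ring
    rw [e, side_add, side_self, zero_add, cross_swap] at h1
    nlinarith

/-- A point of a convex polygon on one of its edges, but not a vertex, lies on no other edge. -/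
theorem IsConvexPolygon.side_pos_of_ne {v : Fin n → ℂ} (hv : IsConvexPolygon v) (hn : 3 ≤ n)
    {x : ℂ} (hx : x ∈ closedRegion v) (hxv : x ∉ Set.range v) {j k : Fin n} (hj : side v j x = 0)
    (hk : k ≠ j) : 0 < side v k x := by
  obtain ⟨t, h0, h1, rfl⟩ := hv.exists_of_side_eq_zero hn hx hj
  have ht0 : 0 < t := lt_of_le_of_ne h0 fun h => hxv ⟨j, by simp [← h]⟩
  have ht1 : t < 1 := lt_of_le_of_ne h1 fun h => hxv ⟨j + 1, by simp [h, edge]⟩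
  have e1 : v (j + 1) = v j + ((1 : ℝ) : ℂ) * edge v j := by simp [edge]
  have e2 := side_add v k (v j) (edge v j) 1
  rw [← e1] at e2
  rw [side_add, show side v k (v j) + t * cross (edge v k) (edge v j) =
    (1 - t) * side v k (v j) + t * side v k (v (j + 1)) by rw [e2]; ring]
  have p1 := hv.side_vertex_nonneg k j
  have p2 := hv.side_vertex_nonneg k (j + 1)
  by_cases hjk : j = k + 1
  · have : 0 < side v k (v (j + 1)) := by
      apply hv
      · rw [hjk]; exact fin_add_two_ne hn k
      · rw [← hjk]; exact fin_add_one_ne (by omega) j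
    have := mul_pos ht0 this
    have := mul_nonneg (sub_nonneg.2 ht1.le) p1
    linarith
  · have : 0 < side v k (v j) := hv k j hk.symm hjk
    have := mul_pos (sub_pos.2 ht1) this
    have := mul_nonneg ht0.le p2
    linarith

/-! ### Germs of polygons -/

/-- Near `x`, the polygon looks like the union of the rays from `x` whose arguments form the arc of
length `φ` that starts at `s`. Directions parallel to edges are disregarded. -/
def IsGerm (v : Fin n → ℂ) (x : ℂ) (s φ : ℝ) : Prop :=
  ∀ θ, (∀ k, cross (edge v k) (unitVec θ) ≠ 0) →
    (θ ∈ arc s φ → ∀ᶠ r : ℝ in 𝓝[>] 0, x + r * unitVec θ ∈ openRegion v) ∧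
    (θ ∉ arc s φ → ∀ᶠ r : ℝ in 𝓝[>] 0, x + r * unitVec θ ∉ openRegion v)

theorem eventually_affine_pos {a b : ℝ} (h : 0 < a ∨ a = 0 ∧ 0 < b) :
    ∀ᶠ r : ℝ in 𝓝[>] 0, 0 < a + r * b := by
  rcases h with h | ⟨rfl, h⟩
  · have hc : Continuous fun r : ℝ => a + r * b := by fun_prop
    have : {r : ℝ | 0 < a + r * b} ∈ 𝓝 (0 : ℝ) :=
      (isOpen_lt continuous_const hc).mem_nhds (by simpa using h)
    exact mem_nhdsWithin_of_mem_nhds this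
  · filter_upwards [self_mem_nhdsWithin] with r hr
    rw [zero_add]
    exact mul_pos hr h

theorem eventually_affine_neg {a b : ℝ} (h : a < 0 ∨ a = 0 ∧ b < 0) :
    ∀ᶠ r : ℝ in 𝓝[>] 0, a + r * b < 0 := by
  have := eventually_affine_pos (a := -a) (b := -b) (by
    rcases h with h | ⟨h1, h2⟩
    · left; linarith
    · right; constructor <;> linarith)
  filter_upwards [this] with r hr
  linarith

theorem isGerm_of_notMem_closedRegion {v : Fin n → ℂ} {x : ℂ} (hx : x ∉ closedRegion v) (s : ℝ) :
    IsGerm v x s 0 := by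
  intro θ _
  refine ⟨fun h => by simp [arc_zero] at h, fun _ => ?_⟩
  obtain ⟨j, hj⟩ : ∃ j, side v j x < 0 := by
    by_contra hcon
    push Not at hcon
    exact hx hcon
  filter_upwards [eventually_affine_neg (b := cross (edge v j) (unitVec θ)) (Or.inl hj)] with r hr hmem
  have := hmem j
  rw [side_add] at this
  exact absurd this (not_lt.2 hr.le)

/-- At a point of the polygon the germ is determined by the edges through this point. -/
theorem isGerm_of_mem_closedRegion {v : Fin n → ℂ} {x : ℂ} (hx : x ∈ closedRegion v) {s φ : ℝ}
    (h : ∀ θ, (∀ k, cross (edge v k) (unitVec θ) ≠ 0) →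
      (θ ∈ arc s φ ↔ ∀ k, side v k x = 0 → 0 < cross (edge v k) (unitVec θ))) :
    IsGerm v x s φ := by
  intro θ hθ
  rw [h θ hθ]
  constructor
  · intro hall
    have : ∀ k, ∀ᶠ r : ℝ in 𝓝[>] 0, 0 < side v k (x + r * unitVec θ) := by
      intro k
      simp only [side_add]
      apply eventually_affine_pos
      rcases (hx k).eq_or_lt with h0 | h0
      · exact Or.inr ⟨h0.symm, hall k h0.symm⟩
      · exact Or.inl h0
    exact eventually_all.2 this
  · intro hnot
    push Not at hnot
    obtain ⟨k, hk, hk'⟩ := hnot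
    filter_upwards [eventually_affine_neg (Or.inr ⟨hk, lt_of_le_of_ne hk' (hθ k)⟩)] with r hr hmem
    have := hmem k
    rw [side_add] at this
    exact absurd this (not_lt.2 hr.le)

/-- An arc shorter than `π` consists of the directions to the left of its first and to the right of its
last ray. -/
theorem mem_arc_iff_sin {s φ θ : ℝ} (h0 : 0 < φ) (hπ : φ < Real.pi) (h1 : Real.sin (θ - s) ≠ 0) :
    θ ∈ arc s φ ↔ 0 < Real.sin (θ - s) ∧ Real.sin (θ - (s + φ)) < 0 := by
  obtain ⟨m, hm1, _⟩ := exists_int_add_mem_Ico s θ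
  rw [← mem_arc_add_int m]
  have hper : ∀ c, Real.sin (θ - c) = Real.sin (θ + 2 * Real.pi * m - c) := fun c => by
    rw [show θ + 2 * Real.pi * m - c = θ - c + m * (2 * Real.pi) by ring,
      Real.sin_add_int_mul_two_pi]
  rw [hper] at h1 ⊢
  rw [hper (s + φ)]
  generalize θ + 2 * Real.pi * m = ψ at *
  have hpi := Real.pi_pos
  constructor
  · rintro ⟨k, hk1, hk2⟩
    have : (k : ℝ) = 0 := by
      have a1 : k < 1 := by
        by_contra hcon
        have : (1 : ℝ) ≤ k := by exact_mod_cast not_lt.1 hcon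
        nlinarith
      have a2 : -1 < k := by
        by_contra hcon
        have : (k : ℝ) ≤ -1 := by exact_mod_cast not_lt.1 hcon
        nlinarith
      have : k = 0 := by omega
      exact_mod_cast this
    rw [this] at hk1 hk2
    constructor
    · exact lt_of_le_of_ne (Real.sin_nonneg_of_nonneg_of_le_pi (by linarith) (by linarith)) h1.symm
    · exact Real.sin_neg_of_neg_of_neg_pi_lt (by linarith) (by linarith)
  · rintro ⟨h3, h4⟩
    refine ⟨0, by simpa using hm1, ?_⟩
    rw [Int.cast_zero, mul_zero, add_zero]
    by_contra hcon
    push Not at hcon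
    rcases le_total ψ (s + φ + Real.pi) with h5 | h5
    · have := Real.sin_nonneg_of_nonneg_of_le_pi (x := ψ - (s + φ)) (by linarith) (by linarith)
      linarith
    · have h6 := Real.sin_nonneg_of_nonneg_of_le_pi (x := ψ - s - Real.pi) (by linarith) (by linarith)
      rw [Real.sin_sub_pi] at h6
      linarith

theorem mem_arc_pi_iff_sin {s θ : ℝ} (h1 : Real.sin (θ - s) ≠ 0) :
    θ ∈ arc s Real.pi ↔ 0 < Real.sin (θ - s) := by
  have hpi := Real.pi_pos
  obtain ⟨m, hm1, hm2⟩ := exists_int_add_mem_Ico s θ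
  have hper : Real.sin (θ - s) = Real.sin (θ + 2 * Real.pi * m - s) := by
    rw [show θ + 2 * Real.pi * m - s = θ - s + m * (2 * Real.pi) by ring,
      Real.sin_add_int_mul_two_pi]
  constructor
  · rintro ⟨k, hk1, hk2⟩
    refine lt_of_le_of_ne ?_ h1.symm
    rw [show θ - s = θ + 2 * Real.pi * k - s - k * (2 * Real.pi) by ring,
      Real.sin_sub_int_mul_two_pi]
    exact Real.sin_nonneg_of_nonneg_of_le_pi (by linarith) (by linarith)
  · intro h
    rw [hper] at h
    refine ⟨m, hm1, ?_⟩
    by_contra hcon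
    push Not at hcon
    have h6 := Real.sin_nonneg_of_nonneg_of_le_pi
      (x := θ + 2 * Real.pi * m - s - Real.pi) (by linarith) (by linarith)
    rw [Real.sin_sub_pi] at h6
    linarith

/-- If `d'` lies to the left of `d`, the argument of `d'` is that of `d` increased by the angle between
the two vectors. -/
theorem angle_of_cross_pos {d d' : ℂ} (h : 0 < cross d d') :
    0 < InnerProductGeometry.angle d d' ∧ InnerProductGeometry.angle d d' < Real.pi ∧
      d' = ‖d'‖ * unitVec (d.arg + InnerProductGeometry.angle d d') := by
  have hd : d ≠ 0 := by rintro rfl; simp [cross] at h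
  have hd' : d' ≠ 0 := by rintro rfl; simp [cross] at h
  have him : 0 < (d' / d).im := by
    have : (d' / d).im = cross d d' / Complex.normSq d := by
      rw [Complex.div_im, cross]; ring
    rw [this]
    exact div_pos h (Complex.normSq_pos.2 hd)
  have harg0 : 0 < (d' / d).arg := by
    refine lt_of_le_of_ne (Complex.arg_nonneg_iff.2 him.le) fun h0 => ?_
    have := (Complex.arg_eq_zero_iff.1 h0.symm).2
    linarith
  have hargpi : (d' / d).arg < Real.pi := by
    refine lt_of_le_of_ne (Complex.arg_le_pi _) fun h0 => ?_
    have := (Complex.arg_eq_pi_iff.1 h0).2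
    linarith
  have hang : InnerProductGeometry.angle d d' = (d' / d).arg := by
    rw [InnerProductGeometry.angle_comm, Complex.angle_eq_abs_arg hd' hd, abs_of_pos harg0]
  rw [hang]
  refine ⟨harg0, hargpi, ?_⟩
  rw [unitVec_add]
  calc d' = d * (d' / d) := by field_simp
    _ = (‖d‖ * unitVec d.arg) * (‖d' / d‖ * unitVec (d' / d).arg) := by
      rw [norm_mul_unitVec_arg, norm_mul_unitVec_arg]
    _ = (‖d‖ * ‖d' / d‖ : ℂ) * (unitVec d.arg * unitVec (d' / d).arg) := by ring
    _ = _ := by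
      congr 1
      rw [norm_div]
      have : (‖d‖ : ℂ) ≠ 0 := by simpa using hd
      push_cast
      field_simp

theorem IsConvexPolygon.cross_prev_pos {v : Fin n → ℂ} (hv : IsConvexPolygon v) (hn : 3 ≤ n)
    (j : Fin n) : 0 < cross (edge v j) (v (j - 1) - v j) := by
  have h := hv.cross_edge_pos hn (j - 1)
  rw [sub_add_cancel] at h
  rw [show v (j - 1) - v j = -edge v (j - 1) by simp [edge], cross_neg_right, cross_swap]
  linarith

/-- At a vertex, the germ consists of the directions between the two adjacent edges. -/
theorem IsConvexPolygon.isGerm_vertex {v : Fin n → ℂ} (hv : IsConvexPolygon v) (hn : 3 ≤ n)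
    (j : Fin n) : IsGerm v (v j) (edge v j).arg (interiorAngle v j) := by
  have hc := hv.cross_prev_pos hn j
  obtain ⟨h0, hπ, hpol⟩ := angle_of_cross_pos hc
  rw [← interiorAngle] at h0 hπ hpol
  refine isGerm_of_mem_closedRegion (fun k => hv.side_vertex_nonneg k j) fun θ hθ => ?_
  have hd : 0 < ‖edge v j‖ := norm_pos_iff.2 (hv.edge_ne_zero hn j)
  have hd' : 0 < ‖v (j - 1) - v j‖ := by
    rw [norm_pos_iff]; intro h; simp [h, cross] at hc
  have e1 := cross_unitVec (edge v j) θ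
  have e2 : cross (edge v (j - 1)) (unitVec θ) =
      -(‖v (j - 1) - v j‖ * Real.sin (θ - ((edge v j).arg + interiorAngle v j))) := by
    rw [← cross_polar]
    rw [← hpol, ← cross_neg_left]
    simp [edge]
  have n1 := hθ j
  rw [e1] at n1
  rw [mem_arc_iff_sin h0 hπ (by intro h; simp [h] at n1)]
  constructor
  · rintro ⟨h1, h2⟩ k hk
    have : k = j ∨ k = j - 1 := by
      by_contra hcon
      push Not at hcon
      have := hv k j hcon.1.symm (fun h => hcon.2 (by rw [h, add_sub_cancel_right]))
      linarith
    rcases this with rfl | rfl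
    · rw [e1]; exact mul_pos hd h1
    · rw [e2]; nlinarith
  · intro h
    have h1 := h j (side_self v j)
    have h2 := h (j - 1) (by have := side_next v (j - 1); rwa [sub_add_cancel] at this)
    rw [e1] at h1
    rw [e2] at h2
    constructor
    · exact pos_of_mul_pos_right h1 hd.le
    · by_contra hcon
      have := mul_nonneg hd'.le (not_lt.1 hcon)
      linarith

/-- The germ of a convex polygon at an arbitrary point of the plane. -/
theorem IsConvexPolygon.exists_isGerm {v : Fin n → ℂ} (hv : IsConvexPolygon v) (hn : 3 ≤ n) (x : ℂ) :
    ∃ s φ, IsGerm v x s φ ∧ 0 ≤ φ ∧ φ ≤ 2 * Real.pi ∧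
      ((∃ j, x = v j ∧ s = (edge v j).arg ∧ φ = interiorAngle v j) ∨
        (x ∉ Set.range v ∧ (x ∉ closedRegion v ∧ φ = 0 ∨
          x ∈ closedRegion v ∧ (φ = Real.pi ∨ φ = 2 * Real.pi)))) := by
  have hpi := Real.pi_pos
  by_cases hxv : x ∈ Set.range v
  · obtain ⟨j, rfl⟩ := hxv
    refine ⟨_, _, hv.isGerm_vertex hn j, InnerProductGeometry.angle_nonneg _ _, ?_,
      Or.inl ⟨j, rfl, rfl, rfl⟩⟩
    have := InnerProductGeometry.angle_le_pi (edge v j) (v (j - 1) - v j)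
    simp only [interiorAngle]
    linarith
  by_cases hx : x ∈ closedRegion v
  · by_cases hj : ∃ j, side v j x = 0
    · obtain ⟨j, hj⟩ := hj
      refine ⟨(edge v j).arg, Real.pi, isGerm_of_mem_closedRegion hx fun θ hθ => ?_, hpi.le,
        by linarith, Or.inr ⟨hxv, Or.inr ⟨hx, Or.inl rfl⟩⟩⟩
      have hd : 0 < ‖edge v j‖ := norm_pos_iff.2 (hv.edge_ne_zero hn j)
      have n1 := hθ j
      rw [cross_unitVec] at n1
      rw [mem_arc_pi_iff_sin (by intro h; simp [h] at n1)]
      constructor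
      · intro h k hk
        obtain rfl : k = j := by
          by_contra hne
          have := hv.side_pos_of_ne hn hx hxv hj hne
          linarith
        rw [cross_unitVec]
        exact mul_pos hd h
      · intro h
        have := h j hj
        rw [cross_unitVec] at this
        exact pos_of_mul_pos_right this hd.le
    · push Not at hj
      refine ⟨0, 2 * Real.pi, isGerm_of_mem_closedRegion hx fun θ hθ => ?_, by linarith, le_rfl,
        Or.inr ⟨hxv, Or.inr ⟨hx, Or.inr rfl⟩⟩⟩
      rw [arc_two_pi]
      simp [hj]
  · exact ⟨0, 0, isGerm_of_notMem_closedRegion hx 0, le_rfl, by linarith,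
      Or.inr ⟨hxv, Or.inl ⟨hx, rfl⟩⟩⟩

theorem finite_cross_unitVec_eq_zero {d : ℂ} (hd : d ≠ 0) :
    ({θ | cross d (unitVec θ) = 0} ∩ Set.Ico 0 (2 * Real.pi)).Finite := by
  refine ((Set.finite_Icc (-5 : ℤ) 5).image fun m : ℤ => d.arg + m * Real.pi).subset ?_
  rintro θ ⟨h, h1, h2⟩
  change cross d (unitVec θ) = 0 at h
  rw [cross_unitVec] at h
  have hs : Real.sin (θ - d.arg) = 0 := by
    rcases mul_eq_zero.1 h with h | h
    · exact absurd (norm_eq_zero.1 h) hd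
    · exact h
  obtain ⟨m, hm⟩ := Real.sin_eq_zero_iff.1 hs
  have hpi := Real.pi_pos
  have a1 := Complex.neg_pi_lt_arg d
  have a2 := Complex.arg_le_pi d
  refine ⟨m, ⟨?_, ?_⟩, by simp only; linarith⟩
  · by_contra hcon
    have : (m : ℝ) ≤ -6 := by exact_mod_cast (by omega : m ≤ -6)
    nlinarith
  · by_contra hcon
    have : (6 : ℝ) ≤ m := by exact_mod_cast (by omega : 6 ≤ m)
    nlinarith

/-- The local form of a tiling: at every point the increments of an integrator along the germs of the
tiles add up to its increment along the germ of the tiled polygon. -/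
theorem sum_germ_increment {ι : Type*} [Fintype ι] {k : ℕ} [NeZero k] (hk : 3 ≤ k) (hn : 3 ≤ n)
    {v : ι → Fin k → ℂ} {p : Fin n → ℂ} (hv : ∀ i, IsConvexPolygon (v i)) (hp : IsConvexPolygon p)
    (hcover : ∀ z, (∀ i j, side (v i) j z ≠ 0) → (∀ j, side p j z ≠ 0) →
      ∑ i, (openRegion (v i)).indicator (1 : ℂ → ℝ) z = (openRegion p).indicator 1 z)
    {x : ℂ} {s φ : ι → ℝ} {s₀ φ₀ : ℝ} (hg : ∀ i, IsGerm (v i) x (s i) (φ i)) (hg₀ : IsGerm p x s₀ φ₀)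
    (hφ : ∀ i, 0 ≤ φ i ∧ φ i ≤ 2 * Real.pi) (hφ₀ : 0 ≤ φ₀ ∧ φ₀ ≤ 2 * Real.pi)
    {ε : ℝ → ℝ} {κ : ℝ} (hε : ∀ θ, ε (θ + 2 * Real.pi) = ε θ + κ) :
    ∑ i, (ε (s i + φ i) - ε (s i)) = ε (s₀ + φ₀) - ε s₀ := by
  classical
  -- the directions of the edges, which have to be avoided
  set B : Set ℝ := (⋃ i, ⋃ j, {θ | cross (edge (v i) j) (unitVec θ) = 0}) ∪
    ⋃ j, {θ | cross (edge p j) (unitVec θ) = 0} with hBdef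
  have hB : (B ∩ Set.Ico 0 (2 * Real.pi)).Finite := by
    rw [hBdef, Set.union_inter_distrib_right]
    refine Set.Finite.union ?_ ?_
    · simp only [Set.iUnion_inter]
      exact Set.finite_iUnion fun i => Set.finite_iUnion fun j =>
        finite_cross_unitVec_eq_zero ((hv i).edge_ne_zero hk j)
    · simp only [Set.iUnion_inter]
      exact Set.finite_iUnion fun j => finite_cross_unitVec_eq_zero (hp.edge_ne_zero hn j)
  have hne : ∀ {a b : ℝ}, b ≠ 0 → ∀ᶠ r : ℝ in 𝓝[>] 0, a + r * b ≠ 0 := by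
    intro a b hb
    rcases lt_trichotomy a 0 with h | h | h
    · exact (eventually_affine_neg (Or.inl h)).mono fun r hr => hr.ne
    · rcases lt_or_gt_of_ne hb with h' | h'
      · exact (eventually_affine_neg (Or.inr ⟨h, h'⟩)).mono fun r hr => hr.ne
      · exact (eventually_affine_pos (Or.inr ⟨h, h'⟩)).mono fun r hr => hr.ne'
    · exact (eventually_affine_pos (Or.inl h)).mono fun r hr => hr.ne'
  have hind : ∀ {m : ℕ} [NeZero m] (w : Fin m → ℂ) (a b θ : ℝ), IsGerm w x a b →
      (∀ j, cross (edge w j) (unitVec θ) ≠ 0) → ∀ᶠ r : ℝ in 𝓝[>] 0,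
        (∀ j, side w j (x + r * unitVec θ) ≠ 0) ∧
        (openRegion w).indicator (1 : ℂ → ℝ) (x + r * unitVec θ) = (arc a b).indicator 1 θ := by
    intro m _ w a b θ hw hθ
    refine Filter.Eventually.and (eventually_all.2 fun j => ?_) ?_
    · simp only [side_add]
      exact hne (hθ j)
    · by_cases h : θ ∈ arc a b
      · filter_upwards [(hw θ hθ).1 h] with r hr
        rw [Set.indicator_of_mem hr, Set.indicator_of_mem h]; rfl
      · filter_upwards [(hw θ hθ).2 h] with r hr
        rw [Set.indicator_of_notMem hr, Set.indicator_of_notMem h]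
  have := sum_increment_eq_zero_of_arcs (ι := Option ι) (fun o => o.elim s₀ s) (fun o => o.elim φ₀ φ)
    (fun o => o.elim (-1) fun _ => 1)
    (by rintro (_ | i); exacts [hφ₀.1, (hφ i).1]) (by rintro (_ | i); exacts [hφ₀.2, (hφ i).2]) hB
    (by
      intro θ hθ
      have h1 : ∀ i j, cross (edge (v i) j) (unitVec θ) ≠ 0 := fun i j h =>
        hθ (Or.inl (Set.mem_iUnion.2 ⟨i, Set.mem_iUnion.2 ⟨j, h⟩⟩))
      have h2 : ∀ j, cross (edge p j) (unitVec θ) ≠ 0 := fun j h =>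
        hθ (Or.inr (Set.mem_iUnion.2 ⟨j, h⟩))
      obtain ⟨r, hr1, hr2⟩ := ((eventually_all.2 fun i => hind (v i) _ _ θ (hg i) (h1 i)).and
        (hind p _ _ θ hg₀ h2)).exists
      have h3 := hcover _ (fun i => (hr1 i).1) hr2.1
      rw [hr2.2, Finset.sum_congr rfl fun i _ => (hr1 i).2] at h3
      rw [Fintype.sum_option]
      simp only [Option.elim, one_mul]
      rw [h3]; ring) hε
  rw [Fintype.sum_option] at this
  simp only [Option.elim, one_mul] at this
  linarith

end Polygon

/-! ### Triangles and regular polygons -/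

theorem fin_three_sub_one (j : Fin 3) : j - 1 = j + 2 := by
  fin_cases j <;> rfl

theorem isConvexPolygon_triangle {v : Fin 3 → ℂ} (h : 0 < cross (v 1 - v 0) (v 2 - v 0)) :
    IsConvexPolygon v := by
  intro j k h1 h2
  fin_cases j <;> fin_cases k <;> simp at h1 h2 <;>
    simp [side, edge, cross] at h ⊢ <;> linarith

/-- The barycentric coordinates of a point with respect to a triangle are proportional to the values
of the three functions `side`. -/
theorem affineCombination_side (t : Affine.Triangle ℝ ℂ)
    (h : 0 < cross (t.points 1 - t.points 0) (t.points 2 - t.points 0)) (z : ℂ) :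
    ∃ w : Fin 3 → ℝ, (∀ j, w j = side t.points (j + 1) z / cross (t.points 1 - t.points 0)
      (t.points 2 - t.points 0)) ∧ ∑ j, w j = 1 ∧
      Finset.univ.affineCombination ℝ t.points w = z := by
  set D := cross (t.points 1 - t.points 0) (t.points 2 - t.points 0) with hD
  refine ⟨fun j => side t.points (j + 1) z / D, fun j => rfl, ?_, ?_⟩
  · rw [← Finset.sum_div, div_eq_one_iff_eq h.ne', hD, Fin.sum_univ_three]
    simp [side, edge, cross]
    ring
  · rw [Finset.affineCombination_eq_linear_combination _ _ _ (by
      rw [← Finset.sum_div, div_eq_one_iff_eq h.ne', hD, Fin.sum_univ_three]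
      simp [side, edge, cross]
      ring)]
    have h' : D ≠ 0 := h.ne'
    rw [Fin.sum_univ_three]
    apply Complex.ext
    · simp only [Complex.add_re, Complex.real_smul, Complex.re_ofReal_mul, div_mul_eq_mul_div]
      rw [← add_div, ← add_div, div_eq_iff h', hD]
      simp [side, edge, cross]
      ring
    · simp only [Complex.add_im, Complex.real_smul, Complex.im_ofReal_mul, div_mul_eq_mul_div]
      rw [← add_div, ← add_div, div_eq_iff h', hD]
      simp [side, edge, cross]
      ring

theorem forall_fin_three_shift {p : Fin 3 → Prop} : (∀ j, p (j + 1)) ↔ ∀ j, p j :=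
  ⟨fun h j => by simpa using h (j - 1), fun h j => h _⟩

theorem closedInterior_eq_closedRegion (t : Affine.Triangle ℝ ℂ)
    (h : 0 < cross (t.points 1 - t.points 0) (t.points 2 - t.points 0)) :
    t.closedInterior = closedRegion t.points := by
  ext z
  obtain ⟨w, hw, hsum, hz⟩ := affineCombination_side t h z
  have h1 : z ∈ closedRegion t.points ↔ ∀ j, 0 ≤ w j := by
    have e : ∀ a : ℝ, 0 ≤ a / cross (t.points 1 - t.points 0) (t.points 2 - t.points 0) ↔ 0 ≤ a :=
      fun a => by rw [le_div_iff₀ h, zero_mul]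
    simp only [hw, e]
    exact (forall_fin_three_shift (p := fun j => 0 ≤ side t.points j z)).symm
  rw [h1]
  conv_lhs => rw [← hz]
  rw [Affine.Simplex.affineCombination_mem_closedInterior_iff hsum]
  refine ⟨fun h j => (h j).1, fun h j => ⟨h j, ?_⟩⟩
  rw [← hsum]
  exact Finset.single_le_sum (fun i _ => h i) (Finset.mem_univ j)

theorem interior_eq_openRegion (t : Affine.Triangle ℝ ℂ)
    (h : 0 < cross (t.points 1 - t.points 0) (t.points 2 - t.points 0)) :
    t.interior = openRegion t.points := by
  ext z
  obtain ⟨w, hw, hsum, hz⟩ := affineCombination_side t h z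
  have h1 : z ∈ openRegion t.points ↔ ∀ j, 0 < w j := by
    simp only [hw, div_pos_iff_of_pos_right h]
    exact (forall_fin_three_shift (p := fun j => 0 < side t.points j z)).symm
  rw [h1]
  conv_lhs => rw [← hz]
  rw [Affine.Simplex.affineCombination_mem_interior_iff hsum]
  refine ⟨fun h j => (h j).1, fun h j => ⟨h j, ?_⟩⟩
  rw [Fin.sum_univ_three] at hsum
  have h0 := h 0
  have h1 := h 1
  have h2 := h 2
  fin_cases j <;> simp <;> linarith

theorem cross_ne_zero_of_triangle (t : Affine.Triangle ℝ ℂ) :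
    cross (t.points 1 - t.points 0) (t.points 2 - t.points 0) ≠ 0 := by
  intro h
  have hne : t.points 1 - t.points 0 ≠ 0 :=
    sub_ne_zero.2 (t.independent.injective.ne (by decide))
  obtain ⟨r, hr⟩ := eq_ofReal_mul_of_cross_eq_zero hne h
  refine affineIndependent_iff_not_collinear.1 t.independent ?_
  rw [collinear_iff_of_mem (Set.mem_range_self 0)]
  refine ⟨t.points 1 - t.points 0, ?_⟩
  rintro _ ⟨j, rfl⟩
  fin_cases j
  · exact ⟨0, by simp⟩
  · exact ⟨1, by simp⟩
  · refine ⟨r, ?_⟩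
    simp only [Complex.real_smul, vadd_eq_add, ← hr]
    simp

theorem interiorAngle_points (t : Affine.Triangle ℝ ℂ) (j : Fin 3) :
    interiorAngle t.points j = triangleAngle t j := by
  rw [interiorAngle, fin_three_sub_one]
  rfl

/-- The vertices of a triangle can be listed counterclockwise. -/
theorem exists_oriented (t : Affine.Triangle ℝ ℂ) : ∃ e : Equiv.Perm (Fin 3),
    IsConvexPolygon (t.points ∘ e) ∧ openRegion (t.points ∘ e) = t.interior ∧
    closedRegion (t.points ∘ e) = t.closedInterior ∧
    ∀ j, interiorAngle (t.points ∘ e) j = triangleAngle t (e j) := by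
  rcases lt_or_gt_of_ne (cross_ne_zero_of_triangle t) with h | h
  · set e : Equiv.Perm (Fin 3) := Equiv.swap 1 2 with he
    have e0 : e 0 = 0 := by decide
    have e1 : e 1 = 2 := by decide
    have e2 : e 2 = 1 := by decide
    have hpts : (t.reindex e).points = t.points ∘ e := by
      have : e.symm = e := Equiv.symm_swap 1 2
      change t.points ∘ e.symm = _
      rw [this]
    have h' : 0 < cross ((t.reindex e).points 1 - (t.reindex e).points 0)
        ((t.reindex e).points 2 - (t.reindex e).points 0) := by
      rw [hpts]
      simp only [Function.comp_apply, e0, e1, e2]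
      rw [cross_swap]
      linarith
    refine ⟨e, ?_, ?_, ?_, fun j => ?_⟩
    · rw [← hpts]; exact isConvexPolygon_triangle h'
    · rw [← hpts, ← interior_eq_openRegion _ h', Affine.Simplex.interior_reindex]
    · rw [← hpts, ← closedInterior_eq_closedRegion _ h', Affine.Simplex.closedInterior_reindex]
    · have key : ∀ j, e (j + 1) = e j + 2 ∧ e (j + 2) = e j + 1 := by decide
      rw [interiorAngle, fin_three_sub_one, triangleAngle, EuclideanGeometry.angle_comm,
        ← (key j).1, ← (key j).2]
      rfl
  · refine ⟨Equiv.refl _, ?_, ?_, ?_, fun j => ?_⟩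
    · exact isConvexPolygon_triangle h
    · exact (interior_eq_openRegion t h).symm
    · exact (closedInterior_eq_closedRegion t h).symm
    · exact interiorAngle_points t j

theorem side_combination {n : ℕ} [NeZero n] (v : Fin n → ℂ) (j : Fin n) (x y : ℂ) {a b : ℝ}
    (hab : a + b = 1) : side v j (a • x + b • y) = a * side v j x + b * side v j y := by
  obtain rfl : b = 1 - a := by linarith
  simp [side, cross]
  ring

theorem convex_closedRegion {n : ℕ} [NeZero n] (v : Fin n → ℂ) : Convex ℝ (closedRegion v) := by
  intro x hx y hy a b ha hb hab j
  rw [side_combination v j x y hab]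
  exact add_nonneg (mul_nonneg ha (hx j)) (mul_nonneg hb (hy j))

theorem regularPolygonVertex_eq (n : ℕ) (c w : ℂ) (k : Fin n) :
    regularPolygonVertex n c w k = c + w * unitVec (2 * Real.pi / n * (k : ℕ)) := by
  rw [regularPolygonVertex, unitVec]
  congr 5
  ring

theorem unitVec_add_two_pi_mul (θ : ℝ) (m : ℕ) : unitVec (θ + 2 * Real.pi * m) = unitVec θ := by
  apply Complex.ext
  · rw [unitVec_re, unitVec_re, mul_comm, Real.cos_add_nat_mul_two_pi]
  · rw [unitVec_im, unitVec_im, mul_comm, Real.sin_add_nat_mul_two_pi]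

theorem unitVec_mod {n : ℕ} (hn : n ≠ 0) (m : ℕ) :
    unitVec (2 * Real.pi / n * (m % n : ℕ)) = unitVec (2 * Real.pi / n * m) := by
  have hn' : (n : ℝ) ≠ 0 := by exact_mod_cast hn
  rw [← unitVec_add_two_pi_mul _ (m / n)]
  congr 1
  have : (m : ℝ) = (m % n : ℕ) + n * (m / n : ℕ) := by exact_mod_cast (Nat.mod_add_div m n).symm
  rw [this]
  field_simp

theorem regularPolygonVertex_add_one {n : ℕ} [NeZero n] (hn : 2 ≤ n) (c w : ℂ) (j : Fin n) :
    regularPolygonVertex n c w (j + 1) =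
      c + w * unitVec (2 * Real.pi / n * (j : ℕ) + 2 * Real.pi / n) := by
  rw [regularPolygonVertex_eq, Fin.val_add, Fin.val_one', Nat.mod_eq_of_lt (show 1 < n by omega),
    unitVec_mod (by omega)]
  congr 3
  push_cast
  ring

/-- Twice the signed area of a triangle inscribed in the unit circle. -/
theorem cross_unitVec_sub (a b ω : ℝ) : cross (unitVec (a + ω) - unitVec a) (unitVec b - unitVec a) =
    4 * Real.sin (ω / 2) * Real.sin ((b - a) / 2) * Real.sin ((b - a - ω) / 2) := by
  obtain ⟨p, rfl⟩ : ∃ p, ω = 2 * p := ⟨ω / 2, by ring⟩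
  obtain ⟨q, rfl⟩ : ∃ q, b = a + 2 * q := ⟨(b - a) / 2, by ring⟩
  rw [show 2 * p / 2 = p by ring, show (a + 2 * q - a) / 2 = q by ring,
    show (a + 2 * q - a - 2 * p) / 2 = q - p by ring, unitVec_add, unitVec_add,
    show unitVec a * unitVec (2 * p) - unitVec a = unitVec a * (unitVec (2 * p) - 1) by ring,
    show unitVec a * unitVec (2 * q) - unitVec a = unitVec a * (unitVec (2 * q) - 1) by ring,
    cross_mul_mul]
  have h1 : Complex.normSq (unitVec a) = 1 := by
    rw [Complex.normSq_apply, unitVec_re, unitVec_im]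
    nlinarith [Real.sin_sq_add_cos_sq a]
  rw [h1]
  simp only [cross, Complex.sub_re, Complex.sub_im, unitVec_re, unitVec_im, Complex.one_re,
    Complex.one_im, Real.sin_two_mul, Real.cos_two_mul, Real.sin_sub]
  have hp := Real.sin_sq_add_cos_sq p
  have hq := Real.sin_sq_add_cos_sq q
  linear_combination (4 * Real.sin q * Real.cos q) * hp - (4 * Real.sin p * Real.cos p) * hq

theorem isConvexPolygon_regularPolygonVertex {n : ℕ} [NeZero n] (hn : 3 ≤ n) (c : ℂ) {w : ℂ}
    (hw : w ≠ 0) : IsConvexPolygon (regularPolygonVertex n c w) := by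
  intro j k hkj hkj'
  have hn0 : (0 : ℝ) < n := by positivity
  have hpi := Real.pi_pos
  rw [side, edge, regularPolygonVertex_add_one (by omega), regularPolygonVertex_eq,
    regularPolygonVertex_eq, add_sub_add_left_eq_sub, add_sub_add_left_eq_sub, ← mul_sub, ← mul_sub,
    cross_mul_mul, cross_unitVec_sub]
  refine mul_pos (Complex.normSq_pos.2 hw) ?_
  have hkj2 : (k : ℕ) ≠ j := fun h => hkj (Fin.ext h)
  have e1 : (2 * Real.pi / n * (k : ℕ) - 2 * Real.pi / n * (j : ℕ)) / 2 =
      ((k : ℕ) - (j : ℕ) : ℝ) * (Real.pi / n) := by ring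
  have e2 : (2 * Real.pi / n * (k : ℕ) - 2 * Real.pi / n * (j : ℕ) - 2 * Real.pi / n) / 2 =
      ((k : ℕ) - (j : ℕ) - 1 : ℝ) * (Real.pi / n) := by ring
  have hq : 0 < Real.pi / n := by positivity
  have hqn : n * (Real.pi / n) = Real.pi := by field_simp
  have hsin : 0 < Real.sin (2 * Real.pi / n / 2) := by
    apply Real.sin_pos_of_pos_of_lt_pi (by positivity)
    rw [show 2 * Real.pi / n / 2 = Real.pi / n by ring]
    exact div_lt_self hpi (by exact_mod_cast (by omega : 1 < n))
  rw [e1, e2, mul_assoc]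
  refine mul_pos (mul_pos (by norm_num) hsin) ?_
  have hj := j.2
  have hk := k.2
  have hval : ((j + 1 : Fin n) : ℕ) = (j + 1) % n := by
    rw [Fin.val_add, Fin.val_one', Nat.mod_eq_of_lt (show 1 < n by omega)]
  rcases lt_or_gt_of_ne hkj2 with h | h
  · -- both factors are negative
    have h3 : (j : ℕ) < k + n - 1 := by
      by_contra hcon
      apply hkj'
      apply Fin.ext
      rw [hval, show (j : ℕ) + 1 = n by omega, Nat.mod_self]
      omega
    have h1' : ((k : ℕ) : ℝ) + 1 ≤ (j : ℕ) := by exact_mod_cast h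
    have h3' : ((j : ℕ) : ℝ) + 2 ≤ (k : ℕ) + n := by exact_mod_cast (by omega : (j : ℕ) + 2 ≤ k + n)
    refine mul_pos_of_neg_of_neg ?_ ?_
    · exact Real.sin_neg_of_neg_of_neg_pi_lt (by nlinarith) (by nlinarith)
    · exact Real.sin_neg_of_neg_of_neg_pi_lt (by nlinarith) (by nlinarith)
  · have h2 : (j : ℕ) + 2 ≤ k := by
      by_contra hcon
      apply hkj'
      apply Fin.ext
      rw [hval, Nat.mod_eq_of_lt (by omega)]
      omega
    have h2' : ((j : ℕ) : ℝ) + 2 ≤ (k : ℕ) := by exact_mod_cast h2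
    have h3' : ((k : ℕ) : ℝ) + 1 ≤ n := by exact_mod_cast hk
    have hj0 : (0 : ℝ) ≤ (j : ℕ) := by positivity
    refine mul_pos ?_ ?_
    · exact Real.sin_pos_of_pos_of_lt_pi (by nlinarith) (by nlinarith)
    · exact Real.sin_pos_of_pos_of_lt_pi (by nlinarith) (by nlinarith)

theorem sum_unitVec_eq_zero {n : ℕ} (hn : 2 ≤ n) :
    ∑ k : Fin n, unitVec (2 * Real.pi / n * (k : ℕ)) = 0 := by
  have hprim := Complex.isPrimitiveRoot_exp n (by omega)
  rw [← hprim.geom_sum_eq_zero (by omega), Finset.sum_range]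
  refine Finset.sum_congr rfl fun k _ => ?_
  rw [unitVec, ← Complex.exp_nat_mul]
  congr 1
  push_cast
  ring

theorem center_mem_convexHull {n : ℕ} (hn : 2 ≤ n) (c w : ℂ) :
    c ∈ convexHull ℝ (Set.range (regularPolygonVertex n c w)) := by
  have hn0 : (n : ℝ) ≠ 0 := by positivity
  have hc : ∑ k : Fin n, ((n : ℝ)⁻¹) • regularPolygonVertex n c w k = c := by
    rw [← Finset.smul_sum]
    simp only [regularPolygonVertex_eq]
    rw [Finset.sum_add_distrib, ← Finset.mul_sum, sum_unitVec_eq_zero hn]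
    simp
    have : (n : ℂ) ≠ 0 := by exact_mod_cast hn0
    field_simp
  have := (convex_convexHull ℝ (Set.range (regularPolygonVertex n c w))).sum_mem
    (t := Finset.univ) (w := fun _ => (n : ℝ)⁻¹) (z := regularPolygonVertex n c w)
    (fun _ _ => by positivity) (by simp [hn0]) fun k _ =>
    subset_convexHull ℝ _ (Set.mem_range_self k)
  rwa [hc] at this

/-- A regular polygon is the intersection of the half planes given by its edges: a point that
satisfies all inequalities lies in the triangle spanned by the centre and one edge. -/
theorem closedRegion_regularPolygonVertex {n : ℕ} [NeZero n] (hn : 3 ≤ n) (c : ℂ) {w : ℂ}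
    (hw : w ≠ 0) : closedRegion (regularPolygonVertex n c w) =
      convexHull ℝ (Set.range (regularPolygonVertex n c w)) := by
  apply Set.Subset.antisymm
  · intro z hz
    have hpi := Real.pi_pos
    have hn0 : (0 : ℝ) < n := by positivity
    have hn3 : (3 : ℝ) ≤ n := by exact_mod_cast hn
    set ω : ℝ := 2 * Real.pi / n with hω
    have hω0 : 0 < ω := by positivity
    have hωn : ω * n = 2 * Real.pi := by rw [hω]; field_simp
    have hωπ : ω < Real.pi := by nlinarith
    have hsin : 0 < Real.sin ω := Real.sin_pos_of_pos_of_lt_pi hω0 hωπ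
    obtain ⟨m, hm1, hm2⟩ := exists_int_add_mem_Ico 0 ((z - c) / w).arg
    set θ := ((z - c) / w).arg + 2 * Real.pi * m with hθ
    set ρ := ‖(z - c) / w‖ with hρ
    have hzρ : z = c + w * (ρ * unitVec θ) := by
      have : unitVec θ = unitVec ((z - c) / w).arg := by
        apply Complex.ext
        · rw [unitVec_re, unitVec_re, hθ, mul_comm, Real.cos_add_int_mul_two_pi]
        · rw [unitVec_im, unitVec_im, hθ, mul_comm, Real.sin_add_int_mul_two_pi]
      rw [this, hρ, norm_mul_unitVec_arg]
      field_simp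
      ring
    -- the sector of the central angle `ω` that contains `z`
    have hfl0 : 0 ≤ θ / ω := by positivity
    have hfl : ⌊θ / ω⌋₊ < n := by
      rw [Nat.floor_lt hfl0, div_lt_iff₀ hω0]
      linarith
    set j : Fin n := ⟨⌊θ / ω⌋₊, hfl⟩ with hj
    have hj1 : ω * (j : ℕ) ≤ θ := by
      have := Nat.floor_le hfl0
      rw [le_div_iff₀ hω0] at this
      simpa [hj, mul_comm] using this
    have hj2 : θ < ω * (j : ℕ) + ω := by
      have := Nat.lt_floor_add_one (θ / ω)
      rw [div_lt_iff₀ hω0] at this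
      have e : ((j : ℕ) : ℝ) = (⌊θ / ω⌋₊ : ℝ) := rfl
      rw [e]; linarith
    set a := ω * (j : ℕ) with ha
    set s := ρ * Real.sin (a + ω - θ) / Real.sin ω with hs
    set t := ρ * Real.sin (θ - a) / Real.sin ω with ht
    have hρ0 : 0 ≤ ρ := norm_nonneg _
    have hs0 : 0 ≤ s := div_nonneg (mul_nonneg hρ0
      (Real.sin_nonneg_of_nonneg_of_le_pi (by linarith) (by linarith))) hsin.le
    have ht0 : 0 ≤ t := div_nonneg (mul_nonneg hρ0
      (Real.sin_nonneg_of_nonneg_of_le_pi (by linarith) (by linarith))) hsin.le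
    have hcomb : (ρ : ℂ) * unitVec θ = s * unitVec a + t * unitVec (a + ω) := by
      have hsc := Real.sin_sq_add_cos_sq a
      have hsc' := Real.sin_sq_add_cos_sq θ
      apply Complex.ext
      · simp only [Complex.add_re, Complex.re_ofReal_mul, unitVec_re, hs, ht]
        field_simp
        rw [show a + ω - θ = (a - θ) + ω by ring]
        simp only [Real.sin_add, Real.sin_sub, Real.cos_add, Real.cos_sub]
        linear_combination (-ρ * Real.sin ω * Real.cos θ) * hsc
      · simp only [Complex.add_im, Complex.im_ofReal_mul, unitVec_im, hs, ht]
        field_simp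
        rw [show a + ω - θ = (a - θ) + ω by ring]
        simp only [Real.sin_add, Real.sin_sub, Real.cos_sub]
        linear_combination (-ρ * Real.sin ω * Real.sin θ) * hsc
    have hva : regularPolygonVertex n c w j = c + w * unitVec a := regularPolygonVertex_eq n c w j
    have hvb : regularPolygonVertex n c w (j + 1) = c + w * unitVec (a + ω) :=
      regularPolygonVertex_add_one (by omega) c w j
    have hst : s + t ≤ 1 := by
      have h := hz j
      rw [side, edge, hva, hvb, hzρ, hcomb, add_sub_add_left_eq_sub, add_sub_add_left_eq_sub,
        ← mul_sub, ← mul_sub, cross_mul_mul] at h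
      have h2 := nonneg_of_mul_nonneg_right h (Complex.normSq_pos.2 hw)
      have e : cross (unitVec (a + ω) - unitVec a)
          (s * unitVec a + t * unitVec (a + ω) - unitVec a) = (1 - s - t) * Real.sin ω := by
        have hsc := Real.sin_sq_add_cos_sq a
        simp only [cross, Complex.sub_re, Complex.sub_im, Complex.add_re, Complex.add_im,
          Complex.re_ofReal_mul, Complex.im_ofReal_mul, unitVec_re, unitVec_im, Real.sin_add,
          Real.cos_add]
        linear_combination ((1 - s - t) * Real.sin ω) * hsc
      rw [e] at h2
      have := nonneg_of_mul_nonneg_left h2 hsin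
      linarith
    have hz' : z = (1 - s - t) • c + s • regularPolygonVertex n c w j +
        t • regularPolygonVertex n c w (j + 1) := by
      rw [hzρ, hcomb, hva, hvb]
      simp only [Complex.real_smul]
      push_cast
      ring
    have hconv := convex_convexHull ℝ (Set.range (regularPolygonVertex n c w))
    have hmem := hconv.sum_mem (t := Finset.univ) (w := ![1 - s - t, s, t])
      (z := ![c, regularPolygonVertex n c w j, regularPolygonVertex n c w (j + 1)])
      (by intro i _; fin_cases i <;> simp <;> linarith)
      (by rw [Fin.sum_univ_three]; simp; ring)
      (by
        intro i _
        fin_cases i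
        · exact center_mem_convexHull (by omega) c w
        · exact subset_convexHull ℝ _ (Set.mem_range_self j)
        · exact subset_convexHull ℝ _ (Set.mem_range_self (j + 1)))
    rw [Fin.sum_univ_three] at hmem
    rw [hz']
    simpa using hmem
  · refine convexHull_min ?_ (convex_closedRegion _)
    rintro _ ⟨k, rfl⟩ j
    exact (isConvexPolygon_regularPolygonVertex hn c hw).side_vertex_nonneg j k

theorem interiorAngle_regularPolygonVertex {n : ℕ} [NeZero n] (hn : 3 ≤ n) (c : ℂ) {w : ℂ}
    (hw : w ≠ 0) (j : Fin n) :
    interiorAngle (regularPolygonVertex n c w) j = Real.pi - 2 * Real.pi / n := by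
  have hpi := Real.pi_pos
  have hn3 : (3 : ℝ) ≤ n := by exact_mod_cast hn
  have hconv := isConvexPolygon_regularPolygonVertex hn c hw
  set ω : ℝ := 2 * Real.pi / n with hω
  have hω0 : 0 < ω := by positivity
  have hωn : ω * n = 2 * Real.pi := by rw [hω]; field_simp
  have hωπ : ω < Real.pi := by nlinarith
  obtain ⟨i, rfl⟩ : ∃ i, j = i + 1 := ⟨j - 1, by simp⟩
  have hx := hconv.edge_ne_zero hn (i + 1)
  have hy := hconv.edge_ne_zero hn i
  have hy' : regularPolygonVertex n c w i - regularPolygonVertex n c w (i + 1) ≠ 0 := by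
    rw [← neg_sub]; exact neg_ne_zero.2 hy
  rw [interiorAngle, add_sub_cancel_right, Complex.angle_eq_abs_arg hx hy']
  set a := ω * (i : ℕ) with ha
  have h0 : regularPolygonVertex n c w i = c + w * unitVec a := regularPolygonVertex_eq n c w i
  have h1 : regularPolygonVertex n c w (i + 1) = c + w * unitVec (a + ω) :=
    regularPolygonVertex_add_one (by omega) c w i
  have h2 : regularPolygonVertex n c w (i + 1 + 1) = c + w * unitVec (a + ω + ω) := by
    rw [regularPolygonVertex_add_one (by omega) c w (i + 1), Fin.val_add, Fin.val_one',
      Nat.mod_eq_of_lt (show 1 < n by omega), unitVec_add, unitVec_mod (by omega), ← unitVec_add]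
    congr 3
    rw [ha, hω]
    push_cast
    ring
  -- the quotient of the two edge vectors, both directed away from the vertex
  have hquot : edge (regularPolygonVertex n c w) (i + 1) /
      (regularPolygonVertex n c w i - regularPolygonVertex n c w (i + 1)) = unitVec (ω - Real.pi) := by
    rw [div_eq_iff hy', edge, h0, h1, h2, sub_eq_add_neg ω, unitVec_add ω, unitVec_add (a + ω),
      unitVec_add a ω]
    have : unitVec (-Real.pi) = -1 := by
      apply Complex.ext <;> simp [unitVec_re, unitVec_im]
    rw [this]
    ring
  rw [hquot, unitVec, Complex.arg_exp_mul_I, (toIocMod_eq_self _).2 ⟨by linarith, by linarith⟩,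
    abs_of_neg (by linarith)]
  ring

/-- Off the lines that contain the edges, a tiling covers every interior point of the polygon
exactly once and no other point. -/
theorem IsTiling.sum_indicator {ι : Type*} [Fintype ι] {T : ι → Affine.Triangle ℝ ℂ} {P : Set ℂ}
    (hT : IsTiling T P) {v : ι → Fin 3 → ℂ} (hopen : ∀ i, openRegion (v i) = (T i).interior)
    (hclosed : ∀ i, closedRegion (v i) = (T i).closedInterior) {n : ℕ} [NeZero n] {p : Fin n → ℂ}
    (hp : closedRegion p = P) (z : ℂ) (h1 : ∀ i j, side (v i) j z ≠ 0) (h2 : ∀ j, side p j z ≠ 0) :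
    ∑ i, (openRegion (v i)).indicator (1 : ℂ → ℝ) z = (openRegion p).indicator 1 z := by
  classical
  by_cases hz : z ∈ openRegion p
  · have hzP : z ∈ ⋃ i, (T i).closedInterior := by
      rw [hT.iUnion_eq, ← hp]
      exact openRegion_subset_closedRegion p hz
    obtain ⟨i, hi⟩ := Set.mem_iUnion.1 hzP
    rw [← hclosed] at hi
    have hi' : z ∈ openRegion (v i) := fun j => lt_of_le_of_ne (hi j) (h1 i j).symm
    rw [Finset.sum_eq_single i]
    · rw [Set.indicator_of_mem hi', Set.indicator_of_mem hz]
    · intro k _ hk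
      refine Set.indicator_of_notMem (fun hk' => ?_) _
      rw [hopen] at hi' hk'
      exact Set.disjoint_left.1 (hT.disjoint k i hk) hk' hi'
    · simp
  · rw [Set.indicator_of_notMem hz]
    refine Finset.sum_eq_zero fun i _ => Set.indicator_of_notMem (fun hi => hz ?_) _
    have hzP : z ∈ closedRegion p := by
      rw [hp, ← hT.iUnion_eq]
      refine Set.mem_iUnion.2 ⟨i, ?_⟩
      rw [← hclosed]
      exact openRegion_subset_closedRegion _ hi
    exact fun j => lt_of_le_of_ne (hzP j) (h2 j).symm

/-! ### Semilinear maps of the plane -/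

/-- `F` turns multiplication by `a` into multiplication by `b`. -/
def IsMultiplier (F : ℂ →+ ℂ) (a b : ℂ) : Prop := ∀ z, F (a * z) = b * F z

theorem IsMultiplier.one (F : ℂ →+ ℂ) : IsMultiplier F 1 1 := fun z => by simp

theorem IsMultiplier.mul {F : ℂ →+ ℂ} {a b a' b' : ℂ} (h : IsMultiplier F a b)
    (h' : IsMultiplier F a' b') : IsMultiplier F (a * a') (b * b') := fun z => by
  rw [mul_assoc, h, h', mul_assoc]

theorem IsMultiplier.add {F : ℂ →+ ℂ} {a b a' b' : ℂ} (h : IsMultiplier F a b)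
    (h' : IsMultiplier F a' b') : IsMultiplier F (a + a') (b + b') := fun z => by
  rw [add_mul, map_add, h, h', add_mul]

theorem IsMultiplier.neg {F : ℂ →+ ℂ} {a b : ℂ} (h : IsMultiplier F a b) :
    IsMultiplier F (-a) (-b) := fun z => by
  rw [neg_mul, map_neg, h, neg_mul]

theorem IsMultiplier.sub {F : ℂ →+ ℂ} {a b a' b' : ℂ} (h : IsMultiplier F a b)
    (h' : IsMultiplier F a' b') : IsMultiplier F (a - a') (b - b') := by
  simpa only [sub_eq_add_neg] using h.add h'.neg

theorem IsMultiplier.pow {F : ℂ →+ ℂ} {a b : ℂ} (h : IsMultiplier F a b) (m : ℕ) :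
    IsMultiplier F (a ^ m) (b ^ m) := by
  induction m with
  | zero => simpa using IsMultiplier.one F
  | succ m ih => simpa only [pow_succ] using ih.mul h

theorem IsMultiplier.ne_zero {F : ℂ →+ ℂ} (hF : F 1 = 1) {a b : ℂ} (h : IsMultiplier F a b)
    (ha : a ≠ 0) : b ≠ 0 := by
  rintro rfl
  have := h a⁻¹
  rw [mul_inv_cancel₀ ha, hF, zero_mul] at this
  exact one_ne_zero this

theorem IsMultiplier.inv {F : ℂ →+ ℂ} (hF : F 1 = 1) {a b : ℂ} (h : IsMultiplier F a b)
    (ha : a ≠ 0) : IsMultiplier F a⁻¹ b⁻¹ := fun z => by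
  have hb := h.ne_zero hF ha
  have := h (a⁻¹ * z)
  rw [mul_inv_cancel_left₀ ha] at this
  rw [this, inv_mul_cancel_left₀ hb]

/-- The automorphism `ζ ↦ ζ ^ k` of a cyclotomic field extends to an additive map of the plane which
is semilinear over that field and maps the real line to itself. -/
theorem exists_semilinear {M k : ℕ} {ζ : ℂ} (hM : 0 < M) (hζ : IsPrimitiveRoot ζ M)
    (hk : k.Coprime M) :
    ∃ F : ℂ →+ ℂ, F 1 = 1 ∧ (∀ x : ℝ, (F x).im = 0) ∧ IsMultiplier F ζ (ζ ^ k) := by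
  have hint : IsIntegral ℚ ζ := (hζ.isIntegral hM).tower_top
  set pb := IntermediateField.adjoin.powerBasis hint with hpb
  have hgen : pb.gen = IntermediateField.AdjoinSimple.gen ℚ ζ :=
    IntermediateField.adjoin.powerBasis_gen hint
  have hroot : Polynomial.aeval (ζ ^ k) (minpoly ℚ pb.gen) = 0 := by
    have h : minpoly ℚ pb.gen = minpoly ℚ ζ := by
      rw [hgen]; exact IntermediateField.minpoly_gen ℚ ζ
    rw [h, ← Polynomial.cyclotomic_eq_minpoly_rat hζ hM,
      Polynomial.cyclotomic_eq_minpoly_rat (hζ.pow_of_coprime k hk) hM]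
    exact minpoly.aeval _ _
  set σ := pb.lift (ζ ^ k) hroot with hσ
  have hσζ : σ (IntermediateField.AdjoinSimple.gen ℚ ζ) = ζ ^ k := by
    rw [← hgen]; exact pb.lift_gen _ _
  -- a linear functional over the cyclotomic field that is `1` at `1`
  obtain ⟨l, hl⟩ := (Algebra.linearMap (IntermediateField.adjoin ℚ {ζ}) ℂ).exists_leftInverse_of_injective
    (LinearMap.ker_eq_bot.2 (algebraMap (IntermediateField.adjoin ℚ {ζ}) ℂ).injective)
  set F₀ : ℂ →+ ℂ := σ.toRingHom.toAddMonoidHom.comp l.toAddMonoidHom with hF₀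
  have hF₀1 : F₀ 1 = 1 := by
    have h1 : l 1 = 1 := by
      have := LinearMap.congr_fun hl 1
      simpa using this
    change σ (l 1) = 1
    rw [h1, map_one]
  have hF₀ζ : IsMultiplier F₀ ζ (ζ ^ k) := by
    intro z
    change σ (l (ζ * z)) = ζ ^ k * σ (l z)
    have : ζ * z = (IntermediateField.AdjoinSimple.gen ℚ ζ) • z := rfl
    rw [this, map_smul, smul_eq_mul, map_mul, hσζ]
  have hnorm : ζ * starRingEnd ℂ ζ = 1 := by
    rw [Complex.mul_conj, Complex.normSq_eq_norm_sq, hζ.norm'_eq_one hM.ne']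
    simp
  have hζ0 : ζ ≠ 0 := left_ne_zero_of_mul_eq_one hnorm
  have hconj : starRingEnd ℂ ζ = ζ⁻¹ := eq_inv_of_mul_eq_one_right hnorm
  have hinv := hF₀ζ.inv hF₀1 hζ0
  -- symmetrize with respect to complex conjugation
  set G : ℂ →+ ℂ := ((starRingEnd ℂ : ℂ →+* ℂ) : ℂ →+ ℂ).comp
    (F₀.comp ((starRingEnd ℂ : ℂ →+* ℂ) : ℂ →+ ℂ)) with hG
  have hGap : ∀ z, G z = starRingEnd ℂ (F₀ (starRingEnd ℂ z)) := fun z => rfl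
  refine ⟨(AddMonoidHom.mulLeft (1 / 2 : ℂ)).comp (F₀ + G), ?_, ?_, ?_⟩
  · simp [hGap, hF₀1]; norm_num
  · intro x
    simp only [AddMonoidHom.comp_apply, AddMonoidHom.add_apply, AddMonoidHom.coe_mulLeft, hGap,
      Complex.conj_ofReal, Complex.add_conj]
    rw [← Complex.ofReal_ofNat, ← Complex.ofReal_one, ← Complex.ofReal_div, ← Complex.ofReal_mul,
      Complex.ofReal_im]
  · intro z
    simp only [AddMonoidHom.comp_apply, AddMonoidHom.add_apply, AddMonoidHom.coe_mulLeft, hGap]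
    rw [hF₀ζ, map_mul, hconj, hinv, map_mul, map_inv₀, map_pow, hconj, inv_pow, inv_inv]
    ring

/-- `F` maps the line spanned by `d` into a line. -/
def PreservesLine (F : ℂ →+ ℂ) (d : ℂ) : Prop := ∀ s t : ℝ, cross (F (s * d)) (F (t * d)) = 0

theorem PreservesLine.ofReal_mul {F : ℂ →+ ℂ} {d : ℂ} (h : PreservesLine F d) (r : ℝ) :
    PreservesLine F (r * d) := fun s t => by
  have := h (s * r) (t * r)
  push_cast at this
  rwa [mul_assoc, mul_assoc] at this

theorem PreservesLine.mul {F : ℂ →+ ℂ} {d a b : ℂ} (h : PreservesLine F d) (hab : IsMultiplier F a b) :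
    PreservesLine F (a * d) := fun s t => by
  rw [mul_left_comm, mul_left_comm (t : ℂ), hab, hab, cross_mul_mul, h, mul_zero]

theorem preservesLine_mul_iff {F : ℂ →+ ℂ} (hF : ∀ a b, IsMultiplier F a b → a ≠ 0 →
    IsMultiplier F a⁻¹ b⁻¹) {d a b : ℂ} (hab : IsMultiplier F a b) (ha : a ≠ 0) :
    PreservesLine F (a * d) ↔ PreservesLine F d := by
  refine ⟨fun h => ?_, fun h => h.mul hab⟩
  have := h.mul (hF a b hab ha)
  rwa [inv_mul_cancel_left₀ ha] at this

theorem preservesLine_ofReal_mul_iff {F : ℂ →+ ℂ} {d : ℂ} {r : ℝ} (hr : r ≠ 0) :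
    PreservesLine F (r * d) ↔ PreservesLine F d := by
  refine ⟨fun h => ?_, fun h => h.ofReal_mul r⟩
  have := h.ofReal_mul r⁻¹
  rwa [Complex.ofReal_inv, inv_mul_cancel_left₀ (by exact_mod_cast hr)] at this

/-- The orthogonal projection of `x` to the line spanned by `d`. -/
def lineProj (x d : ℂ) : ℂ := ((x.re * d.re + x.im * d.im) / Complex.normSq d : ℝ) * d

theorem lineProj_ofReal_mul (x d : ℂ) {r : ℝ} (hr : r ≠ 0) : lineProj x (r * d) = lineProj x d := by
  simp only [lineProj, ← mul_assoc, ← Complex.ofReal_mul, Complex.normSq_mul, Complex.re_ofReal_mul,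
    Complex.im_ofReal_mul, Complex.normSq_ofReal]
  congr 2
  by_cases hd : Complex.normSq d = 0
  · simp [hd]
  · field_simp

open Classical in
/-- A primitive for the cross products `cross (F y) (F z)` along segments `[y, z]` in the direction
`d`, see `linePrimitive_sub`; zero if `F` does not map lines in this direction to lines. -/
def linePrimitive (F : ℂ →+ ℂ) (x d : ℂ) : ℝ :=
  if PreservesLine F d then cross (F x) (F (lineProj x d)) else 0

theorem linePrimitive_ofReal_mul (F : ℂ →+ ℂ) (x d : ℂ) {r : ℝ} (hr : r ≠ 0) :
    linePrimitive F x (r * d) = linePrimitive F x d := by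
  classical
  rw [linePrimitive, linePrimitive, lineProj_ofReal_mul x d hr]
  exact if_congr (preservesLine_ofReal_mul_iff hr) rfl rfl

theorem linePrimitive_neg (F : ℂ →+ ℂ) (x d : ℂ) :
    linePrimitive F x (-d) = linePrimitive F x d := by
  have := linePrimitive_ofReal_mul F x d (r := -1) (by norm_num)
  simpa using this

open Classical in
theorem linePrimitive_sub (F : ℂ →+ ℂ) {d : ℂ} (hd : d ≠ 0) (y : ℂ) :
    linePrimitive F (y + d) d - linePrimitive F y d =
      if PreservesLine F d then cross (F y) (F (y + d)) else 0 := by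
  simp only [linePrimitive]
  split_ifs with h
  · have hd' : Complex.normSq d ≠ 0 := by simpa using hd
    have e : ((y + d).re * d.re + (y + d).im * d.im) / Complex.normSq d =
        (y.re * d.re + y.im * d.im) / Complex.normSq d + 1 := by
      rw [div_add_one hd', Complex.normSq_apply, Complex.add_re, Complex.add_im]
      congr 1; ring
    simp only [lineProj, e]
    set t := (y.re * d.re + y.im * d.im) / Complex.normSq d
    have h1 := h 1 (t + 1)
    rw [Complex.ofReal_one, one_mul] at h1
    rw [map_add, cross_add_left, h1]
    push_cast
    rw [add_mul, one_mul, map_add]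
    simp only [cross_add_right, cross_same]
    ring
  · ring

/-! ### Additivity of the signed area of the image -/

/-- The length of a germ is an interior angle or a multiple of `π`, and a `π`-periodic integrator has
nonzero increments at vertices only. -/
theorem IsConvexPolygon.exists_isGerm_sum {n : ℕ} [NeZero n] {v : Fin n → ℂ} (hv : IsConvexPolygon v)
    (hn : 3 ≤ n) (x : ℂ) [∀ j, Decidable (v j = x)] :
    ∃ s φ, IsGerm v x s φ ∧ (0 ≤ φ ∧ φ ≤ 2 * Real.pi) ∧
      (∃ m : ℕ, φ = (∑ j, if v j = x then interiorAngle v j else 0) + m * Real.pi ∧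
        m ≤ 2 ∧ (x ∈ Set.range v → m = 0)) ∧
      ∀ ε : ℝ → ℝ, (∀ θ, ε (θ + Real.pi) = ε θ) → ε (s + φ) - ε s =
        ∑ j, if v j = x then ε ((edge v j).arg + interiorAngle v j) - ε (edge v j).arg else 0 := by
  obtain ⟨s, φ, hg, h0, h1, h2⟩ := hv.exists_isGerm hn x
  refine ⟨s, φ, hg, ⟨h0, h1⟩, ?_⟩
  rcases h2 with ⟨j, rfl, rfl, rfl⟩ | ⟨hx, h2⟩
  · simp only [(hv.injective hn).eq_iff, Finset.sum_ite_eq', Finset.mem_univ, if_true]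
    exact ⟨⟨0, by simp⟩, fun _ _ => trivial⟩
  · have hx' : ∀ j, v j ≠ x := fun j h => hx ⟨j, h⟩
    simp only [hx', if_false, Finset.sum_const_zero, zero_add]
    have : ∃ m : ℕ, φ = m * Real.pi ∧ m ≤ 2 := by
      rcases h2 with ⟨-, h⟩ | ⟨-, h | h⟩
      · exact ⟨0, by simp [h]⟩
      · exact ⟨1, by simp [h]⟩
      · exact ⟨2, by simp [h]⟩
    obtain ⟨m, hm, hm2⟩ := this
    refine ⟨⟨m, hm, hm2, fun h => absurd h hx⟩, fun ε hε => ?_⟩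
    rw [hm, sub_eq_zero]
    clear hm hm2
    induction m with
    | zero => simp
    | succ m ih =>
      push_cast
      rw [add_mul, one_mul, ← add_assoc, hε, ih]

theorem unitVec_add_pi (θ : ℝ) : unitVec (θ + Real.pi) = -unitVec θ := by
  apply Complex.ext <;> simp [unitVec_re, unitVec_im]

open Classical in
/-- The contribution of the `j`-th edge to (twice) the signed area of the image of a polygon under `F`;
edges on lines that are not mapped to lines are left out. -/
def edgeTerm {n : ℕ} [NeZero n] (F : ℂ →+ ℂ) (c : ℂ) (v : Fin n → ℂ) (j : Fin n) : ℝ :=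
  if PreservesLine F (edge v j) then cross (F (v j - c)) (F (v (j + 1) - c)) else 0

/-- The vertex contributions that come from germs, summed over all vertices of a polygon, give the
contributions of its edges. -/
theorem sum_vertex_increment {n : ℕ} [NeZero n] (hn : 3 ≤ n) (F : ℂ →+ ℂ) (c : ℂ) {v : Fin n → ℂ}
    (hv : IsConvexPolygon v) :
    ∑ j, (linePrimitive F (v j - c) (unitVec ((edge v j).arg + interiorAngle v j)) -
      linePrimitive F (v j - c) (unitVec (edge v j).arg)) = ∑ j, edgeTerm F c v j := by
  have h1 : ∀ j, linePrimitive F (v j - c) (unitVec (edge v j).arg) =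
      linePrimitive F (v j - c) (edge v j) := fun j => by
    conv_rhs => rw [← norm_mul_unitVec_arg (edge v j)]
    rw [linePrimitive_ofReal_mul]
    exact norm_ne_zero_iff.2 (hv.edge_ne_zero hn j)
  have h2 : ∀ j, linePrimitive F (v j - c) (unitVec ((edge v j).arg + interiorAngle v j)) =
      linePrimitive F (v j - c) (edge v (j - 1)) := fun j => by
    have hc := hv.cross_prev_pos hn j
    have hne : ‖v (j - 1) - v j‖ ≠ 0 := by
      rw [norm_ne_zero_iff]; intro h; simp [h, cross] at hc
    have e : edge v (j - 1) = -(‖v (j - 1) - v j‖ *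
        unitVec ((edge v j).arg + interiorAngle v j)) := by
      rw [interiorAngle, ← (angle_of_cross_pos hc).2.2]
      simp [edge]
    rw [e, linePrimitive_neg, linePrimitive_ofReal_mul _ _ _ hne]
  simp only [h1, h2, Finset.sum_sub_distrib]
  rw [← Equiv.sum_comp (Equiv.addRight (1 : Fin n))
    (fun j => linePrimitive F (v j - c) (edge v (j - 1))), ← Finset.sum_sub_distrib]
  refine Finset.sum_congr rfl fun j _ => ?_
  have := linePrimitive_sub F (hv.edge_ne_zero hn j) (v j - c)
  have e : v j - c + edge v j = v (j + 1) - c := by simp only [edge]; ring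
  rw [e] at this
  simpa [edgeTerm] using this

/-- Twice the signed area of the image under an additive map is additive on tilings, as far as edges
on lines that are mapped to lines contribute to it. -/
theorem sum_edgeTerm_eq {ι : Type*} [Fintype ι] {k n : ℕ} [NeZero k] [NeZero n] (hk : 3 ≤ k) (hn : 3 ≤ n)
    {v : ι → Fin k → ℂ} {p : Fin n → ℂ} (hv : ∀ i, IsConvexPolygon (v i)) (hp : IsConvexPolygon p)
    (hcover : ∀ z, (∀ i j, side (v i) j z ≠ 0) → (∀ j, side p j z ≠ 0) →
      ∑ i, (openRegion (v i)).indicator (1 : ℂ → ℝ) z = (openRegion p).indicator 1 z)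
    (F : ℂ →+ ℂ) (c : ℂ) : ∑ i, ∑ j, edgeTerm F c (v i) j = ∑ j, edgeTerm F c p j := by
  classical
  set V : Finset ℂ := (Finset.univ.image fun q : ι × Fin k => v q.1 q.2) ∪ Finset.univ.image p with hV
  have hVv : ∀ i j, v i j ∈ V := fun i j =>
    Finset.mem_union_left _ (Finset.mem_image.2 ⟨(i, j), Finset.mem_univ _, rfl⟩)
  have hVp : ∀ j, p j ∈ V := fun j =>
    Finset.mem_union_right _ (Finset.mem_image.2 ⟨j, Finset.mem_univ _, rfl⟩)
  set ε : ℂ → ℝ → ℝ := fun x θ => linePrimitive F (x - c) (unitVec θ) with hεdef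
  have hε : ∀ x θ, ε x (θ + Real.pi) = ε x θ := fun x θ => by
    simp only [hεdef, unitVec_add_pi, linePrimitive_neg]
  have hε2 : ∀ x θ, ε x (θ + 2 * Real.pi) = ε x θ + 0 := fun x θ => by
    rw [two_mul, ← add_assoc, hε, hε, add_zero]
  have expand : ∀ {m : ℕ} [NeZero m] (hm : 3 ≤ m) (u : Fin m → ℂ), IsConvexPolygon u →
      (∀ j, u j ∈ V) → ∑ j, edgeTerm F c u j = ∑ x ∈ V, ∑ j, if u j = x then
        ε x ((edge u j).arg + interiorAngle u j) - ε x (edge u j).arg else 0 := by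
    intro m _ hm u hu huV
    rw [← sum_vertex_increment hm F c hu, Finset.sum_comm]
    refine Finset.sum_congr rfl fun j _ => ?_
    rw [Finset.sum_ite_eq, if_pos (huV j)]
  rw [expand hn p hp hVp, Finset.sum_congr rfl fun i _ => expand hk (v i) (hv i) (hVv i),
    Finset.sum_comm]
  refine Finset.sum_congr rfl fun x _ => ?_
  choose s φ hg hφ _ hinc using fun i => (hv i).exists_isGerm_sum hk x
  obtain ⟨s₀, φ₀, hg₀, hφ₀, _, hinc₀⟩ := hp.exists_isGerm_sum hn x
  rw [← hinc₀ _ (hε x), ← sum_germ_increment hk hn hv hp hcover hg hg₀ hφ hφ₀ (hε2 x)]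
  exact Finset.sum_congr rfl fun i _ => (hinc i _ (hε x)).symm

theorem sum_fin_three_shift (f : Fin 3 → ℝ) (r : Fin 3) : ∑ j, f j = f r + f (r + 1) + f (r + 2) := by
  rw [Fin.sum_univ_three]
  fin_cases r <;> simp <;> ring

/-- The image of a right triangle, whose legs have ratio `τ`, is oriented according to the sign of the
conjugate `τ'` of `τ`. -/
theorem edgeTerm_rightTriangle {F : ℂ →+ ℂ} (hF : ∀ a b, IsMultiplier F a b → a ≠ 0 →
    IsMultiplier F a⁻¹ b⁻¹) (c : ℂ) {v : Fin 3 → ℂ} {r : Fin 3} {τ τ' : ℝ} (hτ : τ ≠ 0)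
    (hv : v (r + 2) - v r = Complex.I * τ * (v (r + 1) - v r))
    (hmul : IsMultiplier F (Complex.I * τ) (Complex.I * τ')) : 0 ≤ τ' * ∑ j, edgeTerm F c v j := by
  have a1 : r + 1 + 1 = r + 2 := by rw [add_assoc]; rfl
  have a2 : r + 2 + 1 = r := by rw [add_assoc]; simp
  rw [sum_fin_three_shift _ r]
  set d := v (r + 1) - v r with hd
  have e0 : edge v r = d := rfl
  have e1 : edge v (r + 1) = (Complex.I * τ - 1) * d := by
    rw [sub_mul, ← hv, edge, a1, one_mul]; ring
  have e2 : edge v (r + 2) = (-(Complex.I * τ)) * d := by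
    rw [neg_mul, ← hv, edge, a2]; ring
  have n1 : Complex.I * τ - 1 ≠ 0 := by
    intro h
    have := congrArg Complex.re h
    simp at this
  have n2 : -(Complex.I * (τ : ℂ)) ≠ 0 := by
    simpa using hτ
  -- either all edges of the triangle contribute or none does
  have i1 := preservesLine_mul_iff hF (d := d) (hmul.sub (IsMultiplier.one F)) n1
  have i2 := preservesLine_mul_iff hF (d := d) hmul.neg n2
  rw [← e1] at i1
  rw [← e2] at i2
  rw [← e0] at i1 i2
  by_cases h : PreservesLine F (edge v r)
  · rw [edgeTerm, edgeTerm, edgeTerm, if_pos h, if_pos (i1.2 h), if_pos (i2.2 h), a1, a2]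
    set A := F (v r - c) with hA
    have hB : F (v (r + 1) - c) = A + F d := by
      rw [hA, ← map_add, hd]; congr 1; ring
    have hC : F (v (r + 2) - c) = A + Complex.I * τ' * F d := by
      rw [hA, ← hmul, ← map_add, ← hv]; congr 1; ring
    rw [hB, hC]
    have : cross A (A + F d) + cross (A + F d) (A + Complex.I * τ' * F d) +
        cross (A + Complex.I * τ' * F d) A = τ' * Complex.normSq (F d) := by
      simp [cross, Complex.normSq_apply]
      ring
    rw [this, ← mul_assoc]
    exact mul_nonneg (mul_self_nonneg _) (Complex.normSq_nonneg _)
  · rw [edgeTerm, edgeTerm, edgeTerm, if_neg h, if_neg (mt i1.1 h), if_neg (mt i2.1 h)]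
    simp

/-- The Cayley transform `i tan x = (e ^ (2ix) - 1) / (e ^ (2ix) + 1)`. -/
theorem unitVec_two_mul_sub_one (x : ℝ) :
    unitVec (2 * x) - 1 = Complex.I * Real.tan x * (unitVec (2 * x) + 1) ∨ unitVec (2 * x) + 1 = 0 := by
  by_cases h : Real.cos x = 0
  · right
    apply Complex.ext
    · simp [unitVec_re, Real.cos_two_mul, h]
    · simp [unitVec_im, Real.sin_two_mul, h]
  · left
    rw [Real.tan_eq_sin_div_cos]
    have hsc := Real.sin_sq_add_cos_sq x
    apply Complex.ext
    · simp [unitVec_re, unitVec_im, Real.cos_two_mul, Real.sin_two_mul, -Complex.ofReal_div,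
        -Complex.ofReal_sin, -Complex.ofReal_cos]
      field_simp
      linear_combination (2 : ℝ) * hsc
    · simp [unitVec_re, unitVec_im, Real.cos_two_mul, Real.sin_two_mul, -Complex.ofReal_div,
        -Complex.ofReal_sin, -Complex.ofReal_cos]
      field_simp

theorem unitVec_pow (x : ℝ) (m : ℕ) : unitVec x ^ m = unitVec (m * x) := by
  rw [unitVec, unitVec, ← Complex.exp_nat_mul]
  congr 1
  push_cast
  ring

/-- If a regular `n`-gon is tiled by right triangles with an angle `α = lπ / (2n)`, the conjugations of
the `2n`-th cyclotomic field reverse the orientations of the polygon and of the tiles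
simultaneously. -/
theorem tan_mul_sin_nonneg {ι : Type*} [Fintype ι] {n : ℕ} [NeZero n] (hn : 3 ≤ n) (c : ℂ) {w : ℂ}
    (hw : w ≠ 0) {v : ι → Fin 3 → ℂ} (hv : ∀ i, IsConvexPolygon (v i))
    (hcover : ∀ z, (∀ i j, side (v i) j z ≠ 0) → (∀ j, side (regularPolygonVertex n c w) j z ≠ 0) →
      ∑ i, (openRegion (v i)).indicator (1 : ℂ → ℝ) z =
        (openRegion (regularPolygonVertex n c w)).indicator 1 z)
    {α : ℝ} (hα0 : 0 < α) (hα : α < Real.pi / 2) {l k : ℕ} (hl : α = l * (Real.pi / (2 * n)))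
    (hk : k.Coprime (2 * n))
    (hshape : ∀ i, ∃ (r : Fin 3) (τ : ℝ), (τ = Real.tan α ∨ τ = (Real.tan α)⁻¹) ∧
      v i (r + 2) - v i r = Complex.I * τ * (v i (r + 1) - v i r)) :
    0 ≤ Real.tan (k * α) * Real.sin (2 * Real.pi / n * k) := by
  have hn0 : (0 : ℝ) < n := by positivity
  set ζ := unitVec (Real.pi / n) with hζdef
  have hζ : IsPrimitiveRoot ζ (2 * n) := by
    have := Complex.isPrimitiveRoot_exp (2 * n) (by omega)
    convert this using 1
    rw [hζdef, unitVec]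
    congr 1
    push_cast
    field_simp
  obtain ⟨F, hF1, hFre, hFζ⟩ := exists_semilinear (by omega) hζ hk
  -- the multiplier that belongs to `i tan α`
  have hζl : ζ ^ l = unitVec (2 * α) := by
    rw [hζdef, unitVec_pow, hl]; congr 1; field_simp
  have hζkl : (ζ ^ k) ^ l = unitVec (2 * (k * α)) := by
    rw [hζdef, unitVec_pow, unitVec_pow, hl]; congr 1; field_simp
  have hcos : 0 < Real.cos α := Real.cos_pos_of_mem_Ioo ⟨by linarith, hα⟩
  have htan : 0 < Real.tan α := Real.tan_pos_of_pos_of_lt_pi_div_two hα0 hα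
  have hne : unitVec (2 * α) + 1 ≠ 0 := by
    intro h
    have := congrArg Complex.re h
    simp [unitVec_re, Real.cos_two_mul] at this
    exact hcos.ne' this
  have hm1 : IsMultiplier F (unitVec (2 * α)) (unitVec (2 * (k * α))) := by
    rw [← hζl, ← hζkl]; exact hFζ.pow l
  have hp := hm1.add (IsMultiplier.one F)
  have hne' := hp.ne_zero hF1 hne
  have hmul : IsMultiplier F (Complex.I * Real.tan α) (Complex.I * Real.tan (k * α)) := by
    have := (hm1.sub (IsMultiplier.one F)).mul (hp.inv hF1 hne)
    rw [(unitVec_two_mul_sub_one α).resolve_right hne,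
      (unitVec_two_mul_sub_one (k * α)).resolve_right hne', mul_inv_cancel_right₀ hne,
      mul_inv_cancel_right₀ hne'] at this
    exact this
  have hmul' : IsMultiplier F (Complex.I * ((Real.tan α)⁻¹ : ℝ)) (Complex.I * ((Real.tan (k * α))⁻¹ : ℝ)) := by
    have h0 : Complex.I * (Real.tan α : ℂ) ≠ 0 :=
      mul_ne_zero Complex.I_ne_zero (by exact_mod_cast htan.ne')
    have := (hmul.inv hF1 h0).neg
    simpa [mul_inv, Complex.inv_I, mul_comm] using this
  -- rescale, so that the vector `w` to the first vertex becomes `1`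
  set G : ℂ →+ ℂ := F.comp (AddMonoidHom.mulLeft w⁻¹) with hG
  have hGap : ∀ z, G z = F (w⁻¹ * z) := fun z => rfl
  have hGmul : ∀ a b, IsMultiplier G a b ↔ IsMultiplier F a b := by
    intro a b
    constructor
    · intro h z
      have := h (w * z)
      rwa [hGap, hGap, mul_left_comm a, inv_mul_cancel_left₀ hw, inv_mul_cancel_left₀ hw] at this
    · intro h z
      rw [hGap, hGap, mul_left_comm, h]
  have hGinv : ∀ a b, IsMultiplier G a b → a ≠ 0 → IsMultiplier G a⁻¹ b⁻¹ := by
    intro a b h ha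
    rw [hGmul] at h ⊢
    exact h.inv hF1 ha
  have hsum := sum_edgeTerm_eq le_rfl hn hv (isConvexPolygon_regularPolygonVertex hn c hw) hcover G c
  have htiles : ∀ i, 0 ≤ Real.tan (k * α) * ∑ j, edgeTerm G c (v i) j := by
    intro i
    obtain ⟨r, τ, hτ, hvr⟩ := hshape i
    rcases hτ with rfl | rfl
    · exact edgeTerm_rightTriangle hGinv c htan.ne' hvr ((hGmul _ _).2 hmul)
    · -- the sign of the conjugate of `(tan α)⁻¹` is that of the conjugate of `tan α`
      have h := edgeTerm_rightTriangle hGinv c (inv_ne_zero htan.ne') hvr ((hGmul _ _).2 hmul')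
      by_cases ht : Real.tan (k * α) = 0
      · simp [ht]
      · have h2 := mul_nonneg (mul_self_nonneg (Real.tan (k * α))) h
        rwa [← mul_assoc, mul_assoc (Real.tan _), mul_inv_cancel₀ ht, mul_one] at h2
  have hpoly : ∀ j, edgeTerm G c (regularPolygonVertex n c w) j = Real.sin (2 * Real.pi / n * k) := by
    intro j
    have hm : ∀ m : ℕ, IsMultiplier F (unitVec (2 * Real.pi / n * m))
        (unitVec (2 * Real.pi / n * m * k)) := by
      intro m
      have h := hFζ.pow (2 * m)
      rw [hζdef, unitVec_pow, unitVec_pow, unitVec_pow] at h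
      convert h using 2 <;> push_cast <;> ring
    have h0 : regularPolygonVertex n c w j = c + w * unitVec (2 * Real.pi / n * (j : ℕ)) :=
      regularPolygonVertex_eq n c w j
    have h1 : regularPolygonVertex n c w (j + 1) =
        c + w * unitVec (2 * Real.pi / n * ((j : ℕ) + 1 : ℕ)) := by
      rw [regularPolygonVertex_add_one (by omega) c w j]
      congr 3
      push_cast
      ring
    have hedge : edge (regularPolygonVertex n c w) j = w * (unitVec (2 * Real.pi / n * ((j : ℕ) + 1 : ℕ)) -
        unitVec (2 * Real.pi / n * (j : ℕ))) := by
      rw [edge, h0, h1]; ring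
    have hpl : PreservesLine G (edge (regularPolygonVertex n c w) j) := by
      intro s t
      have e : ∀ s : ℝ, G (s * edge (regularPolygonVertex n c w) j) =
          (unitVec (2 * Real.pi / n * ((j : ℕ) + 1 : ℕ) * k) - unitVec (2 * Real.pi / n * (j : ℕ) * k)) *
            F s := by
        intro s
        rw [hGap, hedge, ← ((hm _).sub (hm _)) s]
        congr 1
        field_simp
      rw [e, e, cross_mul_mul, cross, hFre, hFre]
      ring
    have hGv : ∀ m : ℕ, G (c + w * unitVec (2 * Real.pi / n * m) - c) =
        unitVec (2 * Real.pi / n * m * k) := by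
      intro m
      rw [hGap, add_sub_cancel_left, inv_mul_cancel_left₀ hw]
      have := hm m 1
      rwa [mul_one, hF1, mul_one] at this
    rw [edgeTerm, if_pos hpl, h0, h1, hGv, hGv]
    have := cross_polar 1 (2 * Real.pi / n * (j : ℕ) * k) (2 * Real.pi / n * ((j : ℕ) + 1 : ℕ) * k)
    rw [Complex.ofReal_one, one_mul, one_mul] at this
    rw [this]
    congr 1
    push_cast
    ring
  have h := Finset.sum_nonneg fun i (_ : i ∈ Finset.univ) => htiles i
  rw [← Finset.mul_sum, hsum, Finset.sum_congr rfl fun j _ => hpoly j] at h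
  simp only [Finset.sum_const, Finset.card_univ, Fintype.card_fin, nsmul_eq_mul] at h
  rw [mul_left_comm] at h
  exact nonneg_of_mul_nonneg_right h hn0

/-! ### Angles of similar right triangles -/

theorem triangleAngle_pos (t : Affine.Triangle ℝ ℂ) (i : Fin 3) : 0 < triangleAngle t i := by
  obtain ⟨e, hconv, -, -, hang⟩ := exists_oriented t
  have h := (angle_of_cross_pos (hconv.cross_prev_pos le_rfl (e.symm i))).1
  have h2 := hang (e.symm i)
  rw [Equiv.apply_symm_apply, interiorAngle] at h2
  rwa [h2] at h

theorem triangleAngle_sum (t : Affine.Triangle ℝ ℂ) (i : Fin 3) :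
    triangleAngle t i + triangleAngle t (i + 1) + triangleAngle t (i + 2) = Real.pi := by
  have h : t.points 1 ≠ t.points 0 := t.independent.injective.ne (by decide)
  have := EuclideanGeometry.angle_add_angle_add_angle_eq_pi (t.points 2) h
  have e0 : triangleAngle t 0 = EuclideanGeometry.angle (t.points 2) (t.points 0) (t.points 1) :=
    EuclideanGeometry.angle_comm _ _ _
  have e1 : triangleAngle t 1 = EuclideanGeometry.angle (t.points 0) (t.points 1) (t.points 2) :=
    EuclideanGeometry.angle_comm _ _ _
  have e2 : triangleAngle t 2 = EuclideanGeometry.angle (t.points 1) (t.points 2) (t.points 0) :=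
    EuclideanGeometry.angle_comm _ _ _
  rw [← e0, ← e1, ← e2] at this
  fin_cases i <;> simp <;> linarith

theorem smallestAngle_le (t : Affine.Triangle ℝ ℂ) (i : Fin 3) : smallestAngle t ≤ triangleAngle t i := by
  fin_cases i <;> simp [smallestAngle]

theorem exists_eq_smallestAngle (t : Affine.Triangle ℝ ℂ) : ∃ i, smallestAngle t = triangleAngle t i := by
  simp only [smallestAngle]
  rcases min_choice (triangleAngle t 0) (min (triangleAngle t 1) (triangleAngle t 2)) with h | h
  · exact ⟨0, h⟩
  · rcases min_choice (triangleAngle t 1) (triangleAngle t 2) with h' | h'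
    · exact ⟨1, h.trans h'⟩
    · exact ⟨2, h.trans h'⟩

theorem smallestAngle_eq_of_similar {s t : Affine.Triangle ℝ ℂ} (h : SimilarTriangles s t) :
    smallestAngle s = smallestAngle t := by
  obtain ⟨e, he⟩ := h
  have key : ∀ i, triangleAngle s (e i) = triangleAngle t i := by
    intro i
    have h1 := he.index_map ![i + 1, i, i + 2]
    have h2 : ![s.points (e (i + 1)), s.points (e i), s.points (e (i + 2))] ∼
        ![t.points (i + 1), t.points i, t.points (i + 2)] := by
      convert h1 using 1 <;> (funext k; fin_cases k <;> rfl)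
    have h3 := Similar.angle_eq h2
    have h4 : ∀ (e : Equiv.Perm (Fin 3)) (i : Fin 3), e (i + 1) = e i + 1 ∧ e (i + 2) = e i + 2 ∨
        e (i + 1) = e i + 2 ∧ e (i + 2) = e i + 1 := by decide
    rcases h4 e i with ⟨h5, h6⟩ | ⟨h5, h6⟩
    · rw [h5, h6] at h3; exact h3
    · rw [h5, h6, EuclideanGeometry.angle_comm] at h3; exact h3
  apply le_antisymm
  · obtain ⟨i, hi⟩ := exists_eq_smallestAngle t
    rw [hi, ← key]; exact smallestAngle_le _ _
  · obtain ⟨i, hi⟩ := exists_eq_smallestAngle s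
    rw [hi, ← e.apply_symm_apply i, key]; exact smallestAngle_le _ _

/-- The three angles of a right triangle with smaller acute angle `α`. -/
def rightTriangleAngles (α : ℝ) : Fin 3 → ℝ := ![α, Real.pi / 2 - α, Real.pi / 2]

theorem IsRightTriangle.exists_labelling {t : Affine.Triangle ℝ ℂ} (h : IsRightTriangle t) :
    0 < smallestAngle t ∧ smallestAngle t ≤ Real.pi / 4 ∧ ∃ e : Equiv.Perm (Fin 3),
      ∀ j, triangleAngle t j = rightTriangleAngles (smallestAngle t) (e j) := by
  obtain ⟨i, hi⟩ := h
  have hsum := triangleAngle_sum t i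
  have h1 := triangleAngle_pos t (i + 1)
  have h2 := triangleAngle_pos t (i + 2)
  obtain ⟨k, hk⟩ := exists_eq_smallestAngle t
  have l1 := smallestAngle_le t (i + 1)
  have l2 := smallestAngle_le t (i + 2)
  have hpi := Real.pi_pos
  have hk0 := triangleAngle_pos t k
  refine ⟨by linarith, by linarith, ?_⟩
  have cover : ∀ i j : Fin 3, j = i ∨ j = i + 1 ∨ j = i + 2 := by decide
  have hki : k = i + 1 ∨ k = i + 2 := by
    rcases cover i k with rfl | h | h
    · linarith
    · exact Or.inl h
    · exact Or.inr h
  have perms : ∀ i : Fin 3, (∃ e : Equiv.Perm (Fin 3), e i = 2 ∧ e (i + 1) = 0 ∧ e (i + 2) = 1) ∧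
      ∃ e : Equiv.Perm (Fin 3), e i = 2 ∧ e (i + 1) = 1 ∧ e (i + 2) = 0 := by decide
  rcases hki with rfl | rfl
  · obtain ⟨e, a1, a2, a3⟩ := (perms i).1
    refine ⟨e, fun j => ?_⟩
    rcases cover i j with rfl | rfl | rfl
    · rw [a1, hi]; rfl
    · rw [a2, ← hk]; rfl
    · rw [a3]; simp only [rightTriangleAngles, Matrix.cons_val_one, Matrix.cons_val_zero]; linarith
  · obtain ⟨e, a1, a2, a3⟩ := (perms i).2
    refine ⟨e, fun j => ?_⟩
    rcases cover i j with rfl | rfl | rfl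
    · rw [a1, hi]; rfl
    · rw [a2]; simp only [rightTriangleAngles, Matrix.cons_val_one, Matrix.cons_val_zero]; linarith
    · rw [a3, ← hk]; rfl

/-- In a counterclockwise right triangle, the ratio of the legs is the tangent of an acute angle. -/
theorem IsConvexPolygon.leg_eq {v : Fin 3 → ℂ} (hv : IsConvexPolygon v) {r : Fin 3}
    (hr : interiorAngle v r = Real.pi / 2) :
    v (r + 2) - v r = Complex.I * Real.tan (interiorAngle v (r + 1)) * (v (r + 1) - v r) := by
  have hc := hv.cross_prev_pos le_rfl r
  have hpol := (angle_of_cross_pos hc).2.2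
  rw [← interiorAngle, hr, unitVec_add, fin_three_sub_one] at hpol
  rw [fin_three_sub_one] at hc
  have hd : edge v r ≠ 0 := hv.edge_ne_zero le_rfl r
  have he : v (r + 2) - v r ≠ 0 := by
    intro h; simp [h, cross] at hc
  set τ : ℝ := ‖v (r + 2) - v r‖ / ‖edge v r‖ with hτ
  have hτ0 : 0 < τ := div_pos (norm_pos_iff.2 he) (norm_pos_iff.2 hd)
  have hI : unitVec (Real.pi / 2) = Complex.I := by
    apply Complex.ext <;> simp [unitVec_re, unitVec_im]
  have hleg : v (r + 2) - v r = Complex.I * τ * edge v r := by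
    rw [hpol, hI]
    conv_rhs => rw [← norm_mul_unitVec_arg (edge v r)]
    have : (‖edge v r‖ : ℂ) ≠ 0 := by simpa using hd
    rw [hτ]
    push_cast
    field_simp
  have a1 : r + 1 + 1 = r + 2 := by rw [add_assoc]; rfl
  have ang : interiorAngle v (r + 1) = |(1 - Complex.I * τ : ℂ).arg| := by
    have h1 : edge v (r + 1) = (Complex.I * τ - 1) * edge v r := by
      rw [sub_mul, ← hleg, edge, edge, a1]; ring
    have h2 : v (r + 1 - 1) - v (r + 1) = -edge v r := by
      rw [add_sub_cancel_right, edge]; ring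
    rw [interiorAngle, h2, Complex.angle_eq_abs_arg (hv.edge_ne_zero le_rfl _) (neg_ne_zero.2 hd), h1]
    congr 2
    field_simp
    ring
  have harg : (1 - Complex.I * τ : ℂ).arg < 0 := by
    rw [Complex.arg_neg_iff]
    simpa using hτ0
  rw [ang, abs_of_neg harg, Real.tan_neg, Complex.tan_arg]
  rw [edge] at hleg
  simpa using hleg

/-! ### The angle equations -/

/-- The angle equation at a vertex of the `n`-gon: `a` is the smaller acute angle in units of `π`, and
`p`, `q`, `r` are the numbers of smaller acute angles, larger acute angles and right angles. If
`p ≤ q`, only few triples `(p, q, r)` are left, and they determine `a`. -/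
theorem corner_equation {n : ℕ} (hn : 5 ≤ n) {a : ℝ} (ha : 0 < a) (ha' : a ≤ 1 / 4) {p q r : ℕ}
    (h : p * a + q * (1 / 2 - a) + r * (1 / 2) = 1 - 2 / n) :
    (a = 1 / n ∨ a = 2 / n ∨ a = 1 / 6 + 2 / (3 * n)) ∨ q < p ∧ q + r ≤ 1 := by
  have hn5 : (5 : ℝ) ≤ n := by exact_mod_cast hn
  obtain ⟨u, hu⟩ : ∃ u : ℝ, u = 1 / n := ⟨_, rfl⟩
  have hu0 : 0 < u := by rw [hu]; positivity
  have hu5 : u ≤ 1 / 5 := by rw [hu]; exact one_div_le_one_div_of_le (by norm_num) hn5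
  have e1 : (2 : ℝ) / n = 2 * u := by rw [hu]; ring
  have e2 : (2 : ℝ) / (3 * n) = 2 * u / 3 := by rw [hu]; field_simp
  rw [e1, e2, ← hu]
  rw [e1] at h
  have hp0 : (0 : ℝ) ≤ p := by positivity
  have hq0 : (0 : ℝ) ≤ q := by positivity
  have hr0 : (0 : ℝ) ≤ r := by positivity
  rcases lt_or_ge q p with hqp | hpq
  · right
    refine ⟨hqp, ?_⟩
    have h1 : (q : ℝ) + 1 ≤ p := by exact_mod_cast hqp
    have : (q : ℝ) + r < 2 := by nlinarith
    have : q + r < 2 := by exact_mod_cast this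
    omega
  · left
    have hq : (q : ℝ) < 4 := by nlinarith
    have hq : q < 4 := by exact_mod_cast hq
    have hr : (r : ℝ) < 2 := by nlinarith
    have hr : r < 2 := by exact_mod_cast hr
    interval_cases q <;> interval_cases p <;> interval_cases r <;> norm_num at h <;>
      first
      | (exfalso; linarith)
      | (left; linarith)
      | (right; left; linarith)
      | (right; right; linarith)

/-- The integral form of the two equations in `angle_cases`. There `A / (2 * D)` is the smaller acute angle in
units of `π`, `d` is the excess of smaller over larger acute angles at a vertex of the `n`-gon, and `s`
is the number of larger acute and right angles there. -/
theorem angle_arithmetic {A D d s n : ℕ} (hA : 1 ≤ A) (hAD : 2 * A ≤ D) (hD : D ≤ A + 4) (hd : 1 ≤ d)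
    (hs : s ≤ 1) (hn : 5 ≤ n) (h : n * (d * A + s * D) + 4 * D = n * (2 * D)) :
    n * A = 2 * D ∨ n * A = 4 * D ∨ 3 * (n * A) = D * (n + 4) ∨ n = 5 ∧ D = 5 * A ∨
      n = 7 ∧ 7 * A = 3 * D ∨ n = 28 := by
  have hA4 : A ≤ 4 := by omega
  have hD8 : D ≤ 8 := by omega
  have hlt : d * A + s * D < 2 * D := by
    by_contra hcon
    have := Nat.mul_le_mul_left n (not_lt.1 hcon)
    omega
  have hd16 : d < 16 := by nlinarith
  interval_cases A <;> interval_cases D <;> interval_cases s <;> interval_cases d <;> omega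

/-- The angle equation at a vertex of the `n`-gon together with an angle equation of sum `π` or `2π`
in which the larger acute angle prevails. -/
theorem angle_cases {n : ℕ} (hn : 5 ≤ n) (hn28 : n ≠ 28) {a : ℝ} (ha : 0 < a) (ha' : a ≤ 1 / 4)
    {p q r p' q' r' m : ℕ} (h : p * a + q * (1 / 2 - a) + r * (1 / 2) = 1 - 2 / n)
    (hm : m ≤ 2) (h' : p' * a + q' * (1 / 2 - a) + r' * (1 / 2) = m) (hpq' : p' < q') :
    (a = 1 / n ∨ a = 2 / n ∨ a = 1 / 6 + 2 / (3 * n)) ∨ n = 5 ∧ a = 1 / 10 ∨ n = 7 ∧ a = 3 / 14 := by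
  rcases corner_equation hn ha ha' h with h0 | ⟨hpq, hqr⟩
  · exact Or.inl h0
  have hn0 : (n : ℝ) ≠ 0 := by positivity
  obtain ⟨D, rfl⟩ : ∃ D, q' = p' + D := ⟨q' - p', by omega⟩
  obtain ⟨d, rfl⟩ : ∃ d, p = q + d := ⟨p - q, by omega⟩
  push_cast at h h'
  have hD : 1 ≤ D := by omega
  have hD0 : (1 : ℝ) ≤ D := by exact_mod_cast hD
  have hA1 : D * (2 * a) = (p' + D + r' : ℝ) - 2 * m := by linarith
  have hApos : (2 * m : ℝ) < p' + D + r' := by nlinarith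
  have hApos' : 2 * m < p' + D + r' := by exact_mod_cast hApos
  obtain ⟨A, hA⟩ : ∃ A, p' + D + r' = 2 * m + A := ⟨p' + D + r' - 2 * m, by omega⟩
  have hAr : (p' + D + r' : ℝ) = 2 * m + A := by exact_mod_cast hA
  have hDA : D * (2 * a) = (A : ℝ) := by rw [hA1, hAr]; ring
  have hAD : (2 * A : ℝ) ≤ D := by nlinarith
  have hAD' : 2 * A ≤ D := by exact_mod_cast hAD
  have hDR : (D : ℝ) ≠ 0 := by positivity
  have haq : a = A / (2 * D) := by rw [eq_div_iff (by positivity)]; linarith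
  have hcorner : (n : ℝ) * (d * A + (q + r) * D) + 4 * D = n * (2 * D) := by
    have e : (d : ℝ) * (2 * a) + (q + r) = 2 - 4 / n := by
      have : (4 : ℝ) / n = 2 * (2 / n) := by ring
      rw [this]; linarith
    have e2 : (n : ℝ) * (d * (2 * a) + (q + r)) = 2 * n - 4 := by
      rw [e]; field_simp
    rw [← hDA]
    linear_combination (D : ℝ) * e2
  have hcorner' : n * (d * A + (q + r) * D) + 4 * D = n * (2 * D) := by exact_mod_cast hcorner
  rcases angle_arithmetic (by omega) hAD' (by omega) (by omega) hqr hn hcorner' with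
    h1 | h1 | h1 | ⟨rfl, h1⟩ | ⟨rfl, h1⟩ | h1
  · left; left
    have h1 : (n : ℝ) * A = 2 * D := by exact_mod_cast h1
    rw [haq, div_eq_div_iff (by positivity) hn0]; linarith
  · left; right; left
    have h1 : (n : ℝ) * A = 4 * D := by exact_mod_cast h1
    rw [haq, div_eq_div_iff (by positivity) hn0]; linarith
  · left; right; right
    have h1 : 3 * ((n : ℝ) * A) = D * (n + 4) := by exact_mod_cast h1
    rw [haq]; field_simp; linarith
  · right; left
    have h1 : (D : ℝ) = 5 * A := by exact_mod_cast h1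
    refine ⟨rfl, ?_⟩
    rw [haq, div_eq_div_iff (by positivity) (by norm_num)]; linarith
  · right; right
    have h1 : 7 * (A : ℝ) = 3 * D := by exact_mod_cast h1
    refine ⟨rfl, ?_⟩
    rw [haq, div_eq_div_iff (by positivity) (by norm_num)]; linarith
  · exact absurd h1 hn28

/-! ### Counting angles -/

/-- The number of angles with label `l` at the point `x`; `lab i j` is the label of the angle at the
`j`-th vertex of the `i`-th tile. -/
def labelCount {ι : Type*} [Fintype ι] (v : ι → Fin 3 → ℂ) (lab : ι → Fin 3 → Fin 3) (x : ℂ)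
    (l : Fin 3) : ℕ :=
  Nat.card {q : ι × Fin 3 // v q.1 q.2 = x ∧ lab q.1 q.2 = l}

theorem sum_angles_eq {ι : Type*} [Fintype ι] (v : ι → Fin 3 → ℂ) (lab : ι → Fin 3 → Fin 3) (x : ℂ)
    (A : Fin 3 → ℝ) [∀ i j, Decidable (v i j = x)] :
    ∑ i, ∑ j, (if v i j = x then A (lab i j) else 0) = ∑ l, labelCount v lab x l * A l := by
  classical
  have h : ∀ l, (labelCount v lab x l : ℝ) =
      ∑ q : ι × Fin 3, if v q.1 q.2 = x ∧ lab q.1 q.2 = l then 1 else 0 := fun l => by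
    rw [labelCount, Nat.card_eq_fintype_card, Fintype.card_subtype, Finset.sum_boole]
  simp only [h, Finset.sum_mul]
  symm
  rw [Finset.sum_comm, Fintype.sum_prod_type]
  refine Finset.sum_congr rfl fun i _ => Finset.sum_congr rfl fun j _ => ?_
  by_cases hx : v i j = x
  · simp [hx]
  · simp [hx]

/-- Every label occurs once in every tile. -/
theorem sum_labelCount {ι : Type*} [Fintype ι] (v : ι → Fin 3 → ℂ) (lab : ι → Equiv.Perm (Fin 3))
    {V : Finset ℂ} (hV : ∀ i j, v i j ∈ V) (l : Fin 3) :
    ∑ x ∈ V, labelCount v (fun i => lab i) x l = Fintype.card ι := by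
  classical
  have h : ∀ x, labelCount v (fun i => lab i) x l =
      ∑ q : ι × Fin 3, if v q.1 q.2 = x ∧ lab q.1 q.2 = l then 1 else 0 := fun x => by
    rw [labelCount, Nat.card_eq_fintype_card, Fintype.card_subtype, Finset.sum_boole]; rfl
  simp only [h]
  rw [Finset.sum_comm, Fintype.sum_prod_type]
  have : ∀ i, ∑ j, ∑ x ∈ V, (if v i j = x ∧ lab i j = l then 1 else 0) = 1 := by
    intro i
    simp only [ite_and, Finset.sum_ite_eq, hV, if_true]
    rw [Equiv.sum_comp (lab i) (fun j => if j = l then 1 else 0)]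
    simp
  rw [Finset.sum_congr rfl fun i _ => this i]
  simp

/-- The angle equation at an arbitrary point. Off the vertices of the polygon the angle sum is a
multiple of `π`: tiles that contain the point in the interior of a side contribute `π`. -/
theorem angle_equation {ι : Type*} [Fintype ι] {n : ℕ} [NeZero n] (hn : 3 ≤ n)
    {v : ι → Fin 3 → ℂ} {p : Fin n → ℂ} (hv : ∀ i, IsConvexPolygon (v i)) (hp : IsConvexPolygon p)
    (hcover : ∀ z, (∀ i j, side (v i) j z ≠ 0) → (∀ j, side p j z ≠ 0) →
      ∑ i, (openRegion (v i)).indicator (1 : ℂ → ℝ) z = (openRegion p).indicator 1 z)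
    {lab : ι → Fin 3 → Fin 3} {A : Fin 3 → ℝ} (hA : ∀ l, 0 ≤ A l)
    (hlab : ∀ i j, interiorAngle (v i) j = A (lab i j)) (x : ℂ) :
    (∀ j, p j = x → interiorAngle p j < Real.pi →
      ∑ l, labelCount v lab x l * A l = interiorAngle p j) ∧
    (x ∉ Set.range p → ∃ m : ℕ, m ≤ 2 ∧ ∑ l, labelCount v lab x l * A l = m * Real.pi) := by
  classical
  have hpi := Real.pi_pos
  choose s φ hg hφ hm _ using fun i => (hv i).exists_isGerm_sum le_rfl x
  choose m hm _ _ using hm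
  obtain ⟨s₀, φ₀, hg₀, hφ₀, ⟨m₀, hm₀, hm₀2, hm₀0⟩, _⟩ := hp.exists_isGerm_sum hn x
  have h := sum_germ_increment le_rfl hn hv hp hcover hg hg₀ hφ hφ₀ (ε := fun θ => θ)
    (κ := 2 * Real.pi) (fun θ => rfl)
  simp only [add_sub_cancel_left] at h
  rw [Finset.sum_congr rfl fun i _ => hm i, Finset.sum_add_distrib, hm₀, ← Finset.sum_mul,
    ← Nat.cast_sum] at h
  simp only [hlab] at h
  rw [sum_angles_eq] at h
  have hnonneg : 0 ≤ ∑ l, (labelCount v lab x l : ℝ) * A l :=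
    Finset.sum_nonneg fun l _ => mul_nonneg (by positivity) (hA l)
  set M := ∑ i, m i with hM
  constructor
  · rintro j rfl hj
    simp only [(hp.injective hn).eq_iff, Finset.sum_ite_eq', Finset.mem_univ, if_true] at h
    rw [hm₀0 (Set.mem_range_self j), Nat.cast_zero, zero_mul, add_zero] at h
    have : (M : ℝ) < 1 := by nlinarith
    have : M = 0 := by
      have : M < 1 := by exact_mod_cast this
      omega
    rw [this] at h
    simpa using h
  · intro hx
    have hx' : ∀ j, p j ≠ x := fun j h => hx ⟨j, h⟩
    simp only [hx', if_false, Finset.sum_const_zero, zero_add] at h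
    have hle : M ≤ m₀ := by
      have : (M : ℝ) * Real.pi ≤ m₀ * Real.pi := by linarith
      exact_mod_cast le_of_mul_le_mul_right this hpi
    refine ⟨m₀ - M, by omega, ?_⟩
    rw [Nat.cast_sub hle]
    linarith

end

theorem theorem2 (n : ℕ) (hn : 5 ≤ n) (hn28 : n ≠ 28) (P : Set ℂ) (hP : IsRegularPolygon n P)
    {ι : Type*} [Finite ι] (T : ι → Affine.Triangle ℝ ℂ) (hT : IsTiling T P)
    (hright : ∀ i, IsRightTriangle (T i)) (hsim : ∀ i j, SimilarTriangles (T i) (T j))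
    (i : ι) :
    smallestAngle (T i) ∈
      ({Real.pi / n, 2 * Real.pi / n, Real.pi / 6 + 2 * Real.pi / (3 * n)} : Set ℝ) := by
  classical
  have := Fintype.ofFinite ι
  have : NeZero n := ⟨by omega⟩
  have hpi := Real.pi_pos
  have hn3 : 3 ≤ n := by omega
  have hn0 : (n : ℝ) ≠ 0 := by exact_mod_cast (by omega : n ≠ 0)
  obtain ⟨-, c, w, hw, rfl⟩ := hP
  set p := regularPolygonVertex n c w with hp
  have hpconv : IsConvexPolygon p := isConvexPolygon_regularPolygonVertex hn3 c hw
  set α := smallestAngle (T i) with hα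
  have hαi : ∀ k, smallestAngle (T k) = α := fun k => smallestAngle_eq_of_similar (hsim k i)
  have hα0 : 0 < α := ((hright i).exists_labelling).1
  have hα4 : α ≤ Real.pi / 4 := ((hright i).exists_labelling).2.1
  choose e hconv hopen hclosed hang using fun k => exists_oriented (T k)
  choose lab' hlab' using fun k => ((hright k).exists_labelling).2.2
  set v : ι → Fin 3 → ℂ := fun k => (T k).points ∘ e k with hv
  set lab : ι → Equiv.Perm (Fin 3) := fun k => (e k).trans (lab' k) with hlabdef
  have hlab : ∀ k j, interiorAngle (v k) j = rightTriangleAngles α (lab k j) := fun k j => by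
    rw [hang, hlab', hαi]; rfl
  have hcover := hT.sum_indicator hopen hclosed
    (closedRegion_regularPolygonVertex hn3 c hw)
  have hA : ∀ l, 0 ≤ rightTriangleAngles α l := by
    intro l
    fin_cases l <;> simp [rightTriangleAngles] <;> linarith
  have heq := angle_equation hn3 hconv hpconv hcover hA (lab := fun k => lab k) hlab
  set N := labelCount v (fun k => lab k) with hN
  obtain ⟨a, ha⟩ : ∃ a, α = a * Real.pi := ⟨α / Real.pi, by field_simp⟩
  have ha0 : 0 < a := by
    rw [ha] at hα0; exact pos_of_mul_pos_left hα0 hpi.le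
  have ha4 : a ≤ 1 / 4 := by
    rw [ha] at hα4
    exact le_of_mul_le_mul_right (by linarith) hpi
  have hscale : ∀ x (t : ℝ), ∑ l, (N x l : ℝ) * rightTriangleAngles α l = t * Real.pi →
      N x 0 * a + N x 1 * (1 / 2 - a) + N x 2 * (1 / 2) = t := by
    intro x t h
    rw [Fin.sum_univ_three, show rightTriangleAngles α 0 = α from rfl,
      show rightTriangleAngles α 1 = Real.pi / 2 - α from rfl,
      show rightTriangleAngles α 2 = Real.pi / 2 from rfl, ha] at h
    refine mul_right_cancel₀ hpi.ne' ?_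
    linarith
  have hcorner : ∀ j, N (p j) 0 * a + N (p j) 1 * (1 / 2 - a) + N (p j) 2 * (1 / 2) = 1 - 2 / n := by
    intro j
    have hint := interiorAngle_regularPolygonVertex hn3 c hw j
    apply hscale
    rw [(heq (p j)).1 j rfl (by rw [hint]; have : 0 < 2 * Real.pi / n := by positivity
                                linarith), hint]
    ring
  have hgoal : (a = 1 / n ∨ a = 2 / n ∨ a = 1 / 6 + 2 / (3 * n)) → α ∈
      ({Real.pi / n, 2 * Real.pi / n, Real.pi / 6 + 2 * Real.pi / (3 * n)} : Set ℝ) := by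
    simp only [Set.mem_insert_iff, Set.mem_singleton_iff]
    rintro (h | h | h)
    · left; rw [ha, h]; ring
    · right; left; rw [ha, h]; ring
    · right; right; rw [ha, h]; ring
  by_contra hcon
  have hlt : ∀ j, N (p j) 1 < N (p j) 0 := fun j =>
    ((corner_equation hn ha0 ha4 (hcorner j)).resolve_left fun h => hcon (hgoal h)).1
  -- in the whole tiling the two acute angles occur equally often
  obtain ⟨x, hx⟩ : ∃ x, N x 0 < N x 1 := by
    by_contra hall
    push Not at hall
    set V : Finset ℂ := insert (p 0) (Finset.univ.image fun q : ι × Fin 3 => v q.1 q.2) with hV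
    have hVv : ∀ i j, v i j ∈ V := fun i j =>
      Finset.mem_insert_of_mem (Finset.mem_image.2 ⟨(i, j), Finset.mem_univ _, rfl⟩)
    have h0 := sum_labelCount v lab hVv 0
    have h1 := sum_labelCount v lab hVv 1
    have := Finset.sum_lt_sum (fun x (_ : x ∈ V) => hall x) ⟨p 0, Finset.mem_insert_self _ _, hlt 0⟩
    rw [← hN] at h0 h1
    omega
  have hxp : x ∉ Set.range p := by
    rintro ⟨j, rfl⟩
    exact absurd hx (not_lt.2 (hlt j).le)
  obtain ⟨m, hm, hmx⟩ := (heq x).2 hxp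
  -- the legs of every tile have ratio `tan α` or its inverse
  have hshape : ∀ k, ∃ (r : Fin 3) (τ : ℝ), (τ = Real.tan α ∨ τ = (Real.tan α)⁻¹) ∧
      v k (r + 2) - v k r = Complex.I * τ * (v k (r + 1) - v k r) := by
    intro k
    set r := (lab k).symm 2 with hr
    have hlr : lab k r = 2 := (lab k).apply_symm_apply 2
    refine ⟨r, Real.tan (interiorAngle (v k) (r + 1)), ?_, (hconv k).leg_eq (by
      rw [hlab, hlr]; rfl)⟩
    rw [hlab]
    have hne : lab k (r + 1) ≠ 2 := by
      rw [← hlr]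
      exact (lab k).injective.ne (fin_add_one_ne (by omega) r)
    have h01 : ∀ l : Fin 3, l ≠ 2 → l = 0 ∨ l = 1 := by decide
    rcases h01 _ hne with h | h
    · left; rw [h]; rfl
    · right; rw [h, ← Real.tan_pi_div_two_sub]; rfl
  rcases angle_cases hn hn28 ha0 ha4 (hcorner 0) hm (hscale x m hmx) hx with
    h | ⟨h5, h⟩ | ⟨h7, h⟩
  · exact hcon (hgoal h)
  · -- under `ζ ↦ ζ ^ 3` the tiles keep their orientation, and the pentagon reverses it
    have hn5 : (n : ℝ) = 5 := by exact_mod_cast h5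
    have key := tan_mul_sin_nonneg hn3 c hw hconv hcover hα0 (by linarith) (l := 1) (k := 3)
      (by rw [ha, h, hn5]; push_cast; ring) (by rw [h5]; decide) hshape
    rw [ha, h, hn5] at key
    have h1 : 0 < Real.tan ((3 : ℕ) * (1 / 10 * Real.pi)) := by
      apply Real.tan_pos_of_pos_of_lt_pi_div_two <;> push_cast <;> linarith
    have h2 : Real.sin (2 * Real.pi / 5 * (3 : ℕ)) < 0 := by
      rw [← Real.sin_sub_two_pi]
      apply Real.sin_neg_of_neg_of_neg_pi_lt <;> push_cast <;> linarith
    nlinarith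
  · -- under `ζ ↦ ζ ^ 3` the tiles reverse their orientation, and the heptagon keeps it
    have hn7 : (n : ℝ) = 7 := by exact_mod_cast h7
    have key := tan_mul_sin_nonneg hn3 c hw hconv hcover hα0 (by linarith) (l := 3) (k := 3)
      (by rw [ha, h, hn7]; push_cast; ring) (by rw [h7]; decide) hshape
    rw [ha, h, hn7] at key
    have h1 : Real.tan ((3 : ℕ) * (3 / 14 * Real.pi)) < 0 := by
      rw [← Real.tan_sub_pi]
      apply Real.tan_neg_of_neg_of_pi_div_two_lt <;> push_cast <;> linarith
    have h2 : 0 < Real.sin (2 * Real.pi / 7 * (3 : ℕ)) := by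
      apply Real.sin_pos_of_pos_of_lt_pi <;> push_cast <;> linarith
    nlinarith
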